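/- For integers $m_1,\dots,m_r\ge 1$, let $$\mathbb{T}(m_1,\dots,m_r)=\langle c_1,\dots,c_r \mid c_1^{m_1},\dots,c_r^{m_r},\ c_1c_2\cdots c_r\rangle$$ be the polygonal group of signature $(m_1,\dots,m_r)$. Then $\mathbb{T}(2,3,8)$ has no finite quotient of order $1152$ or $2016$; that is, if $G$ is a group of order $1152$ or $2016$, there is no surjective homomorphism $\mathbb{T}(2,3,8)\to G$. -/

import Mathlib

/-- The relators `c₁ ^ m₁, …, c_r ^ m_r` and `c₁ * ⋯ * c_r` (product in this order) of the polygonal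
group of signature `(m₁, …, m_r)`, in the free group on `c₁, …, c_r`. -/
def polygonalRels {r : ℕ} (m : Fin r → ℕ) : Set (FreeGroup (Fin r)) :=
  Set.range (fun i => FreeGroup.of i ^ m i) ∪ {(List.ofFn fun i => FreeGroup.of i).prod}

/-- The polygonal group `𝕋(m₁, …, m_r) = ⟨c₁, …, c_r | c₁ ^ m₁, …, c_r ^ m_r, c₁ ⋯ c_r⟩`. -/
abbrev PolygonalGroup {r : ℕ} (m : Fin r → ℕ) : Type :=
  PresentedGroup (polygonalRels m)

/-! ### Parity of involutions, Burnside transfer, prime-order subgroups -/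

open MulAction

/-! A quotient is generated by x, y with x² = y³ = z⁸ = 1, where z = xy. Two tools recur. If z⁴
dies, what remains is a quotient of the (2,3,4) group, which is S₄, so its order is divisible by
neither 7 nor 9 (`IsTriangleGen.card_dvd_of_pow_four`). By Burnside transfer
(`Sylow.eq_one_of_commute_normalizer`), a nontrivial element of an abelian Sylow subgroup Q that is
centralised by the normaliser of Q forces a nontrivial homomorphism to Q.

Order 1152: on the 9 cosets of a Sylow 2-subgroup, z is an 8-cycle with one fixed point. The
relations leave two candidates for x, and for both some word fixes one point and moves another in a
3-cycle, although point stabilisers are 2-groups.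

Order 2016: there are 1, 8, 36 or 288 Sylow 7-subgroups. Transfer excludes 288 in G, and 1 in the
subgroup L generated by y and its x-conjugate. For 36, L is perfect of order 504·2^k. Stripping
central involutions reduces to order 504, where element counting leaves no element of order 4
(`Sylow.sq_mem_center`). Hence z⁴ is central in L, so 7 divides the order of the centre of L,
against transfer.

For 8, the degree 8 action has image of order 336 and kernel of order 6. Modulo a normal subgroup of
order 3 the kernel becomes a central involution. It is odd on the 42 cosets of a dihedral subgroup
of order 16 but trivial in degree 8, while G has only one nontrivial sign character
(`IsTriangleGen.card_ker_toPermHom_ne_six`). -/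

theorem sign_toPerm_of_sq_eq_one {G X : Type*} [Group G] [MulAction G X] [Fintype X]
    [DecidableEq X] {t : G} (ht : t ^ 2 = 1) :
    Equiv.Perm.sign (toPermHom G X t) = (-1) ^ ((Nat.card X - Nat.card (fixedBy X t)) / 2) := by
  have h : (toPermHom G X t) ^ 2 = 1 := by rw [← map_pow, ht, map_one]
  rw [Equiv.Perm.sign_of_pow_two_eq_one h, Nat.card_eq_fintype_card]
  congr 3
  rw [Nat.card_eq_fintype_card]
  apply Fintype.card_congr
  exact Equiv.setCongr rfl

theorem card_modEq_card_fixedBy {G X : Type*} [Group G] [MulAction G X] [Finite X] {t : G}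
    (ht : t ^ 2 = 1) : Nat.card X ≡ Nat.card (fixedBy X t) [MOD 2] := by
  have h2 : IsPGroup 2 (Subgroup.zpowers t) := by
    rintro ⟨g, n, rfl⟩
    refine ⟨1, Subtype.ext ?_⟩
    simp only [pow_one, Subgroup.coe_pow, Subgroup.coe_one]
    rw [← zpow_natCast, zpow_comm, zpow_natCast, ht, one_zpow]
  have := h2.card_modEq_card_fixedPoints X
  convert this using 2
  congr 1
  ext a
  simp only [mem_fixedBy, mem_fixedPoints, Subtype.forall, Subgroup.mk_smul]
  constructor
  · intro h m hm
    obtain ⟨n, rfl⟩ := hm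
    exact mem_stabilizer_iff.1 (zpow_mem (mem_stabilizer_iff.2 h) n)
  · intro h
    exact h t (Subgroup.mem_zpowers t)

/-- The sign of the action is a character, hence trivial, so `t` swaps an even number of pairs. -/
theorem card_fixedBy_mod_four {G X : Type*} [Group G] [MulAction G X] [Finite X]
    (hG : ∀ χ : G →* ℤˣ, χ = 1) {t : G} (ht : t ^ 2 = 1) :
    Nat.card X % 4 = Nat.card (fixedBy X t) % 4 := by
  classical
  have := Fintype.ofFinite X
  have h1 := sign_toPerm_of_sq_eq_one (X := X) ht
  have h2 := card_modEq_card_fixedBy (X := X) ht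
  have h3 := DFunLike.congr_fun (hG (Equiv.Perm.sign.comp (toPermHom G X))) t
  simp only [MonoidHom.comp_apply, MonoidHom.one_apply] at h3
  rw [h3] at h1
  have h4 : Nat.card (fixedBy X t) ≤ Nat.card X := Nat.card_le_card_of_injective _ Subtype.val_injective
  have h5 : Even ((Nat.card X - Nat.card (fixedBy X t)) / 2) := by
    by_contra h
    rw [Nat.not_even_iff_odd] at h
    rw [h.neg_one_pow] at h1
    exact absurd h1 (by decide)
  obtain ⟨r, hr⟩ := h5
  unfold Nat.ModEq at h2
  omega

/-- Fusion in an abelian Sylow subgroup is controlled by its normaliser, so every conjugate of a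
power of `e` lying in `Q` equals that power. Transfer into `Q` therefore sends `e` to its power by
the index, which is prime to the order of `e`. -/
theorem Sylow.eq_one_of_commute_normalizer {G : Type*} [Group G] [Finite G] {p : ℕ}
    [Fact p.Prime] (Q : Sylow p G) (hQ : ∀ a ∈ Q, ∀ b ∈ Q, a * b = b * a)
    (hG : ∀ χ : G →* (Q : Subgroup G), ∀ g, χ g = 1) {e : G} (he : e ∈ Q)
    (hN : ∀ n ∈ Subgroup.normalizer (Q : Set G), n * e = e * n) : e = 1 := by
  have : IsMulCommutative (Q : Subgroup G) := ⟨⟨fun a b => Subtype.ext (hQ a a.2 b b.2)⟩⟩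
  have key : ∀ (k : ℕ) (g₀ : G), g₀⁻¹ * e ^ k * g₀ ∈ (Q : Subgroup G) →
      g₀⁻¹ * e ^ k * g₀ = e ^ k := by
    intro k g₀ h
    obtain ⟨n, hn, h⟩ := Q.conj_eq_normalizer_conj_of_mem (e ^ k) g₀ (pow_mem he k) h
    have hc : Commute n e := hN n hn
    rw [h]
    exact (hc.pow_right k).inv_mul_cancel
  open scoped IsMulCommutative in
  have h := MonoidHom.transfer_eq_pow (MonoidHom.id (Q : Subgroup G)) e key
  rw [hG] at h
  have h1 : e ^ (Q : Subgroup G).index = 1 := (congrArg Subtype.val h).symm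
  have h2 : ¬ p ∣ (Q : Subgroup G).index := Q.not_dvd_index
  have h3 : orderOf e ∣ (Q : Subgroup G).index := orderOf_dvd_of_pow_eq_one h1
  obtain ⟨n, hn⟩ := Q.2 ⟨e, he⟩
  have hn' : e ^ p ^ n = 1 := congrArg Subtype.val hn
  obtain ⟨m, -, hm⟩ := (Nat.dvd_prime_pow Fact.out).1 (orderOf_dvd_of_pow_eq_one hn')
  rcases m with _ | m
  · exact orderOf_eq_one_iff.1 (by simpa using hm)
  · exact absurd ((Dvd.intro_left _ (pow_succ p m).symm).trans (hm ▸ h3)) h2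

theorem MonoidHom.eq_one_of_commutator_eq_top {G A : Type*} [Group G] [CommGroup A]
    (h : commutator G = ⊤) (χ : G →* A) : χ = 1 := by
  have := Abelianization.commutator_subset_ker χ
  rw [h, top_le_iff] at this
  ext g
  exact MonoidHom.mem_ker.1 (this ▸ Subgroup.mem_top g)

theorem MonoidHom.map_eq_one_of_commutator_eq_top {G A : Type*} [Group G] [Group A]
    (hA : ∀ a b : A, a * b = b * a) (h : commutator G = ⊤) (χ : G →* A) (g : G) : χ g = 1 := by
  let _ : CommGroup A := { mul_comm := hA }
  rw [MonoidHom.eq_one_of_commutator_eq_top h χ]; rfl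

theorem Sylow.card_eq_of_card_eq {G : Type*} [Group G] [Finite G] {p : ℕ} [hp : Fact p.Prime]
    {n m : ℕ} (h : Nat.card G = p ^ n * m) (hm : ¬ p ∣ m) (P : Sylow p G) :
    Nat.card (P : Subgroup G) = p ^ n := by
  have hm0 : m ≠ 0 := by rintro rfl; simp at hm
  have := P.card_eq_multiplicity
  rw [h, Nat.factorization_mul (pow_ne_zero _ hp.out.ne_zero) hm0] at this
  simpa [hp.out.factorization_self, Nat.factorization_eq_zero_of_not_dvd hm] using this

/-- Count modulo p the fixed points of `P` acting on `H` by conjugation: 1 cannot be the only one.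
-/
theorem Subgroup.exists_commute_of_le_normalizer {G : Type*} [Group G] {p : ℕ} [Fact p.Prime]
    {P H : Subgroup G} [Finite H] (hP : IsPGroup p P) (hPH : P ≤ Subgroup.normalizer (H : Set G))
    (hH : ¬ Nat.card H ≡ 1 [MOD p]) : ∃ h ∈ H, h ≠ 1 ∧ ∀ a ∈ P, a * h = h * a := by
  let _ : MulAction P H :=
    MulAction.compHom H (H.normalizerMonoidHom.comp (Subgroup.inclusion hPH))
  have h1 := hP.card_modEq_card_fixedPoints H
  have hsm : ∀ (a : P) (h : H), ((a • h : H) : G) = a * h * (a : G)⁻¹ := fun a h => rfl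
  by_contra hcon
  push Not at hcon
  apply hH
  have : fixedPoints P H = {1} := by
    ext h
    simp only [mem_fixedPoints, Set.mem_singleton_iff]
    constructor
    · intro hh
      by_contra hne
      obtain ⟨a, ha, hab⟩ := hcon h h.2 (fun h' => hne (Subtype.ext h'))
      apply hab
      have := congrArg Subtype.val (hh ⟨a, ha⟩)
      rw [hsm] at this
      exact mul_inv_eq_iff_eq_mul.1 this
    · rintro rfl a
      apply Subtype.ext
      rw [hsm]; simp
  rw [this] at h1
  simpa using h1

/-- Translates of the fixed points of an involution inverting a group `P` of odd order whose
nontrivial elements act freely on `Y`. -/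
theorem card_mul_card_fixed_le {G X : Type*} [Group G] [MulAction G X] [Finite X] {P : Subgroup G}
    (hodd : ∀ a ∈ P, a ^ 2 = 1 → a = 1) {t : G}
    (htP : ∀ a ∈ P, t * a = a⁻¹ * t) (Y F : Set X)
    (hY : ∀ a ∈ P, ∀ u ∈ Y, a • u ∈ Y ∧ (a • u = u → a = 1)) (hFY : F ⊆ Y)
    (hF : ∀ u ∈ F, t • u = u) :
    Nat.card P * Nat.card F ≤ Nat.card Y := by
  rw [← Nat.card_prod]
  refine Nat.card_le_card_of_injective
    (fun q : P × F => (⟨(q.1 : G) • (q.2 : X), (hY _ q.1.2 _ (hFY q.2.2)).1⟩ : Y)) ?_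
  rintro ⟨⟨a, ha⟩, ⟨u, hu⟩⟩ ⟨⟨b, hb⟩, ⟨v, hv⟩⟩ h
  have h1 : a • u = b • v := congrArg Subtype.val h
  -- Applying `t` inverts both coefficients. Since `P` is inverted by `t` it is abelian, so the two
  -- equations combine to show that `(b⁻¹ * a) ^ 2` fixes `u`.
  have h2 : a⁻¹ • u = b⁻¹ • v := by
    have := congrArg (t • ·) h1
    simp only [← mul_smul, htP a ha, htP b hb] at this
    rwa [mul_smul, mul_smul, hF u hu, hF v hv] at this
  have h3 : v = (b * a⁻¹) • u := by rw [mul_smul, h2, smul_inv_smul]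
  have h4 : (b⁻¹ * a) • u = v := by rw [mul_smul, h1, inv_smul_smul]
  have hcomm : Commute b⁻¹ a := by
    have h5 := htP (b⁻¹ * a) (mul_mem (inv_mem hb) ha)
    rw [← mul_assoc, htP _ (inv_mem hb), mul_assoc, htP a ha, ← mul_assoc,
      mul_left_inj, mul_inv_rev] at h5
    have h6 := congrArg (fun g => g⁻¹) h5
    simp only [mul_inv_rev, inv_inv] at h6
    exact h6.symm
  have h5 : (b⁻¹ * a) ^ 2 = 1 := by
    refine (hY _ (pow_mem (mul_mem (inv_mem hb) ha) 2) u (hFY hu)).2 ?_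
    rw [pow_two, mul_smul, h4, h3, ← mul_smul, hcomm.eq]
    group
    simp
  have h6 := hodd _ (mul_mem (inv_mem hb) ha) h5
  have h7 : a = b := by rw [← inv_mul_eq_one.1 h6]
  subst h7
  have h8 : u = v := by simpa using h1
  subst h8
  rfl

theorem Subgroup.pow_eq_one_of_card_eq {G : Type*} [Group G] {n : ℕ} {H : Subgroup G}
    (hH : Nat.card H = n) {a : G} (ha : a ∈ H) : a ^ n = 1 := by
  have := pow_card_eq_one' (x := (⟨a, ha⟩ : H))
  rw [hH] at this
  exact congrArg Subtype.val this

theorem Subgroup.eq_of_card_eq_prime {G : Type*} [Group G] {p : ℕ} [hp : Fact p.Prime]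
    {H K : Subgroup G} (hH : Nat.card H = p) (hK : Nat.card K = p) {a : G} (haH : a ∈ H)
    (haK : a ∈ K) (ha : a ≠ 1) : H = K := by
  have key : ∀ {H : Subgroup G}, Nat.card H = p → a ∈ H → Subgroup.zpowers a = H := by
    intro H hH haH
    have : Finite H := Nat.finite_of_card_ne_zero (hH ▸ hp.out.ne_zero)
    refine Subgroup.eq_of_le_of_card_ge (by simpa using haH) ?_
    have h1 : a ^ p = 1 := Subgroup.pow_eq_one_of_card_eq hH haH
    rw [hH, Nat.card_zpowers, orderOf_eq_prime h1 ha]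
  rw [← key hH haH, ← key hK haK]

theorem Subgroup.commute_of_card_eq_prime {G : Type*} [Group G] {p : ℕ} [hp : Fact p.Prime]
    {H : Subgroup G} (hH : Nat.card H = p) {g e : G} (he : e ∈ H) (he1 : e ≠ 1)
    (hge : g * e = e * g) : ∀ a ∈ H, g * a = a * g := by
  intro a ha
  have h1 : orderOf e = p := orderOf_eq_prime (Subgroup.pow_eq_one_of_card_eq hH he) he1
  have h2 : Subgroup.zpowers e = H := by
    have : Finite H := Nat.finite_of_card_ne_zero (hH ▸ hp.out.ne_zero)
    exact Subgroup.eq_of_le_of_card_ge (by simpa using he) (by rw [hH, Nat.card_zpowers, h1])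
  rw [← h2] at ha
  obtain ⟨n, rfl⟩ := ha
  exact (show Commute g e from hge).zpow_right n

/-! ### Sylow 7-subgroups of order 7 and central involutions -/

namespace Sylow

variable {G : Type*} [Group G]

theorem commute_of_card_prime {p : ℕ} [hp : Fact p.Prime] {P : Sylow p G}
    (hP : Nat.card (P : Subgroup G) = p) : ∀ a ∈ P, ∀ b ∈ P, a * b = b * a := by
  intro a ha b hb
  have := isCyclic_of_prime_card hP
  have := IsCyclic.isMulCommutative (α := (P : Subgroup G))
  exact congrArg Subtype.val (this.is_comm.comm ⟨a, ha⟩ ⟨b, hb⟩)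

theorem self_smul {p : ℕ} {P : Sylow p G} {a : G} (ha : a ∈ P) : a • P = P :=
  smul_eq_iff_mem_normalizer.2 (Subgroup.le_normalizer ha)

theorem eq_of_smul_eq {p : ℕ} [hp : Fact p.Prime] {P A : Sylow p G}
    (hcard : ∀ P : Sylow p G, Nat.card (P : Subgroup G) = p) {a : G} (ha : a ∈ P)
    (hA : a • A = A) (ha1 : a ≠ 1) : A = P := by
  have h1 : IsPGroup p (Subgroup.zpowers a) := P.2.to_le (Subgroup.zpowers_le.2 ha)
  have h2 := h1.inf_normalizer_sylow A
  have h3 : a ∈ Subgroup.zpowers a ⊓ Subgroup.normalizer (A : Set G) :=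
    ⟨Subgroup.mem_zpowers a, smul_eq_iff_mem_normalizer.1 hA⟩
  rw [h2] at h3
  exact Sylow.ext (Subgroup.eq_of_card_eq_prime (hcard A) (hcard P) h3.2 ha ha1)

variable [Finite G]

theorem normalizerMonoidHom_sq {P : Sylow 7 G} (hP : Nat.card (P : Subgroup G) = 7)
    (h3 : ¬ 3 ∣ Nat.card (Subgroup.normalizer (P : Set G)))
    (g : Subgroup.normalizer (P : Set G)) :
    ((P : Subgroup G).normalizerMonoidHom g) ^ 2 = 1 := by
  have : Fact (Nat.Prime 7) := ⟨by norm_num⟩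
  have := isCyclic_of_prime_card hP
  have h6 : Nat.card (MulAut (P : Subgroup G)) = 6 := by
    rw [IsCyclic.card_mulAut, hP]; rfl
  set α := (P : Subgroup G).normalizerMonoidHom g with hα
  have h1 : orderOf α ∣ 6 := h6 ▸ orderOf_dvd_natCard α
  have h2 : orderOf α ∣ Nat.card (Subgroup.normalizer (P : Set G)) :=
    (orderOf_map_dvd _ g).trans (orderOf_dvd_natCard g)
  have h4 : orderOf α ≤ 6 := Nat.le_of_dvd (by norm_num) h1
  have h5 : ¬ 3 ∣ orderOf α := fun h => h3 (h.trans h2)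
  apply orderOf_dvd_iff_pow_eq_one.1
  interval_cases orderOf α <;> omega

/-- The automorphism induced by `g` has square 1, so `a * (g * a * g⁻¹)` is fixed by `g`. If it is
ever nontrivial it generates `P`. -/
theorem commute_or_inv {P : Sylow 7 G} (hP : Nat.card (P : Subgroup G) = 7)
    (h3 : ¬ 3 ∣ Nat.card (Subgroup.normalizer (P : Set G))) {g : G}
    (hg : g ∈ Subgroup.normalizer (P : Set G)) :
    (∀ a ∈ P, g * a = a * g) ∨ (∀ a ∈ P, g * a = a⁻¹ * g) := by
  have : Fact (Nat.Prime 7) := ⟨by norm_num⟩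
  have hsq : ∀ a ∈ P, g * (g * a * g⁻¹) * g⁻¹ = a := by
    intro a ha
    have h1 := DFunLike.congr_fun (normalizerMonoidHom_sq hP h3 ⟨g, hg⟩) ⟨a, ha⟩
    exact congrArg Subtype.val h1
  have hmem : ∀ a ∈ P, g * a * g⁻¹ ∈ P := fun a ha =>
    (Subgroup.mem_normalizer_iff.1 hg a).1 ha
  by_cases h : ∀ a ∈ P, a * (g * a * g⁻¹) = 1
  · right
    intro a ha
    rw [← eq_inv_of_mul_eq_one_right (h a ha)]; group
  · left
    push Not at h
    obtain ⟨a, ha, hne⟩ := h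
    refine Subgroup.commute_of_card_eq_prime hP (mul_mem ha (hmem a ha)) hne ?_
    have h2 : g * (a * (g * a * g⁻¹)) * g⁻¹ = a * (g * a * g⁻¹) := by
      rw [← conj_mul, hsq a ha]
      exact commute_of_card_prime hP _ (hmem a ha) _ ha
    exact mul_inv_eq_iff_eq_mul.1 h2

/-- Otherwise the normaliser centralises `P`, and transfer contradicts perfectness. -/
theorem exists_inv (hG : commutator G = ⊤) {P : Sylow 7 G} (hP : Nat.card (P : Subgroup G) = 7)
    (h3 : ¬ 3 ∣ Nat.card (Subgroup.normalizer (P : Set G))) :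
    ∃ v ∈ Subgroup.normalizer (P : Set G), ∀ a ∈ P, v * a = a⁻¹ * v := by
  have : Fact (Nat.Prime 7) := ⟨by norm_num⟩
  by_contra! hcon
  have h1 : ∀ v ∈ Subgroup.normalizer (P : Set G), ∀ a ∈ P, v * a = a * v := by
    intro v hv
    refine (commute_or_inv hP h3 hv).resolve_right (fun h => ?_)
    obtain ⟨a, ha, hne⟩ := hcon v hv
    exact hne (h a ha)
  have : Nontrivial (P : Subgroup G) := by
    rw [← Finite.one_lt_card_iff_nontrivial, hP]; norm_num
  obtain ⟨⟨e, he⟩, hne⟩ := exists_ne (1 : (P : Subgroup G))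
  apply hne
  apply Subtype.ext
  have hcomm := commute_of_card_prime hP
  exact P.eq_one_of_commute_normalizer hcomm
    (MonoidHom.map_eq_one_of_commutator_eq_top
      (fun a b => Subtype.ext (hcomm a a.2 b b.2)) hG) he (fun n hn => h1 n hn e he)

/-- The 35 Sylow subgroups other than `P` form five regular `P`-orbits, each with at most one point
fixed by `t`. -/
theorem card_fixedBy_le_of_inv (hcard : ∀ P : Sylow 7 G, Nat.card (P : Subgroup G) = 7)
    (h36 : Nat.card (Sylow 7 G) = 36) {P : Sylow 7 G} {t : G}
    (ht : ∀ a ∈ P, t * a = a⁻¹ * t) : Nat.card (fixedBy (Sylow 7 G) t) ≤ 6 := by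
  have : Fact (Nat.Prime 7) := ⟨by norm_num⟩
  have h1 := card_mul_card_fixed_le (P := (P : Subgroup G)) (t := t)
    (Y := {A : Sylow 7 G | A ≠ P}) (F := {A | A ≠ P ∧ t • A = A}) ?_ ht ?_ (fun A hA => hA.1)
    (fun A hA => hA.2)
  · have h2 : Nat.card {A : Sylow 7 G | A ≠ P} = 35 := by
      have := Set.ncard_add_ncard_compl {A : Sylow 7 G | A ≠ P}
      have h3 : {A : Sylow 7 G | A ≠ P}ᶜ = {P} := by ext; simp
      rw [h3, Set.ncard_singleton, h36] at this
      rw [Nat.card_coe_set_eq]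
      omega
    rw [hcard, h2, Nat.card_coe_set_eq] at h1
    have h3 : fixedBy (Sylow 7 G) t ⊆ insert P {A | A ≠ P ∧ t • A = A} := by
      intro A hA
      by_cases hAP : A = P
      · exact Or.inl hAP
      · exact Or.inr ⟨hAP, hA⟩
    have h4 := Set.ncard_le_ncard h3
    have h5 := Set.ncard_insert_le P {A | A ≠ P ∧ t • A = A}
    rw [Nat.card_coe_set_eq]
    omega
  · intro a ha ha2
    have h7 := Subgroup.pow_eq_one_of_card_eq (hcard P) ha
    rwa [show 7 = 2 * 3 + 1 from rfl, pow_succ, pow_mul, ha2, one_pow, one_mul] at h7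
  · intro a ha A hA
    refine ⟨fun h => hA ?_, fun h => by_contra fun h1 => hA (eq_of_smul_eq hcard ha h h1)⟩
    rw [← self_smul ha] at h
    exact smul_left_cancel _ h

/-- Let f be the number of Sylow 7-subgroups fixed by `t`. Parity gives 4 ∣ f, and the action of `P`
on them gives f ≡ 1 mod 7. So f > 6, and `t` cannot invert a Sylow subgroup: it centralises each one
it fixes. All of these are then conjugate in the centraliser C of `t`, so f is the index of the
normaliser of `P` in C. Hence f divides 36, which forces f = 36 and C = G. -/
theorem mem_center_of_commute_normalizer (hG : commutator G = ⊤)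
    (hcard : ∀ P : Sylow 7 G, Nat.card (P : Subgroup G) = 7)
    (h36 : Nat.card (Sylow 7 G) = 36)
    (h3 : ∀ P : Sylow 7 G, ¬ 3 ∣ Nat.card (Subgroup.normalizer (P : Set G)))
    {P : Sylow 7 G} {t : G} (ht : t ^ 2 = 1)
    (htN : ∀ n ∈ Subgroup.normalizer (P : Set G), n * t = t * n) : t ∈ Subgroup.center G := by
  have : Fact (Nat.Prime 7) := ⟨by norm_num⟩
  have htP : ∀ a ∈ P, a * t = t * a := fun a ha => htN a (Subgroup.le_normalizer ha)
  have hfix : t • P = P := by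
    refine smul_eq_iff_mem_normalizer.2 (Subgroup.mem_normalizer_iff.2 fun a => ?_)
    constructor
    · intro ha
      change a ∈ P at ha
      rw [← htP a ha, mul_inv_cancel_right]; exact ha
    · intro ha
      have := htP _ ha
      rw [inv_mul_cancel_right, mul_right_inj] at this
      rwa [← this] at ha
  have h4 := card_fixedBy_mod_four (X := Sylow 7 G)
    (MonoidHom.eq_one_of_commutator_eq_top hG) ht
  have h7 : Nat.card (fixedBy (Sylow 7 G) t) ≡ 1 [MOD 7] := by
    let _ : MulAction (P : Subgroup G) (fixedBy (Sylow 7 G) t) :=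
      { smul a A := ⟨(a : G) • (A : Sylow 7 G), by
          rw [mem_fixedBy, ← mul_smul, ← htP a a.2, mul_smul, A.2]⟩
        one_smul A := Subtype.ext (one_smul G (A : Sylow 7 G))
        mul_smul a b A := Subtype.ext (mul_smul (a : G) (b : G) (A : Sylow 7 G)) }
    have h1 := P.2.card_modEq_card_fixedPoints (fixedBy (Sylow 7 G) t)
    have h2 : fixedPoints (P : Subgroup G) (fixedBy (Sylow 7 G) t) = {⟨P, hfix⟩} := by
      ext A
      simp only [mem_fixedPoints, Set.mem_singleton_iff]
      constructor
      · intro h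
        have : Nontrivial (P : Subgroup G) := by
          rw [← Finite.one_lt_card_iff_nontrivial, hcard]; norm_num
        obtain ⟨e, hne⟩ := exists_ne (1 : (P : Subgroup G))
        exact Subtype.ext (eq_of_smul_eq hcard e.2 (congrArg Subtype.val (h e))
          (fun h => hne (Subtype.ext h)))
      · rintro rfl a
        exact Subtype.ext (self_smul a.2)
    rw [h2] at h1
    simpa using h1
  have hle : Nat.card (fixedBy (Sylow 7 G) t) ≤ 36 :=
    h36 ▸ Nat.card_le_card_of_injective _ Subtype.val_injective
  have h6 : 6 < Nat.card (fixedBy (Sylow 7 G) t) := by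
    unfold Nat.ModEq at h7; omega
  have hcomm : ∀ A : Sylow 7 G, t • A = A → ∀ a ∈ A, t * a = a * t := by
    intro A hA
    refine (commute_or_inv (hcard A) (h3 A) (smul_eq_iff_mem_normalizer.1 hA)).resolve_right ?_
    intro h
    have := card_fixedBy_le_of_inv hcard h36 h
    omega
  let C := Subgroup.centralizer {t}
  have hC : ∀ g, g ∈ C ↔ t * g = g * t := fun g =>
    Subgroup.mem_centralizer_singleton_iff.trans eq_comm
  have hPC : (P : Subgroup G) ≤ C := fun a ha => (hC a).2 (htP a ha).symm
  have horb : orbit C P = fixedBy (Sylow 7 G) t := by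
    ext A
    constructor
    · rintro ⟨c, rfl⟩
      change t • (c : G) • P = (c : G) • P
      rw [← mul_smul, (hC c).1 c.2, mul_smul, hfix]
    · intro hA
      have hAC : (A : Subgroup G) ≤ C := fun a ha => (hC a).2 (hcomm A hA a ha)
      obtain ⟨c, hc⟩ := exists_smul_eq C (P.subtype hPC) (A.subtype hAC)
      rw [smul_subtype] at hc
      exact ⟨c, subtype_injective hc⟩
  have hst : Nat.card (stabilizer C P) = Nat.card (Subgroup.normalizer (P : Set G)) := by
    have h1 : stabilizer C P = (Subgroup.normalizer (P : Set G)).subgroupOf C := by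
      ext c
      rw [mem_stabilizer_iff, Subgroup.mem_subgroupOf, ← smul_eq_iff_mem_normalizer]
      rfl
    rw [h1]
    exact Nat.card_congr
      (Subgroup.subgroupOfEquivOfLe (fun n hn => (hC n).2 (htN n hn).symm)).toEquiv
  have h8 := Subgroup.card_mul_index (stabilizer C P)
  rw [index_stabilizer, horb, hst, ← Nat.card_coe_set_eq] at h8
  have h9 := Subgroup.card_mul_index (Subgroup.normalizer (P : Set G))
  rw [← card_eq_index_normalizer, h36] at h9
  have h10 : Nat.card (fixedBy (Sylow 7 G) t) ∣ 36 := by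
    have := C.card_subgroup_dvd_card
    rw [← h8, ← h9] at this
    exact Nat.dvd_of_mul_dvd_mul_left Nat.card_pos this
  have h11 : Nat.card (fixedBy (Sylow 7 G) t) = 36 := by
    unfold Nat.ModEq at h7
    generalize Nat.card (fixedBy (Sylow 7 G) t) = f at *
    interval_cases f <;> omega
  rw [h11, h9] at h8
  have htop : C = ⊤ := Subgroup.eq_top_of_card_eq C h8.symm
  rw [Subgroup.mem_center_iff]
  intro g
  exact ((hC g).1 (htop ▸ Subgroup.mem_top g)).symm

end Sylow

namespace Sylow

variable {G : Type*} [Group G] [Finite G]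

/-- The normaliser N induces at most two automorphisms on `P`, so a Sylow 2-subgroup T of N, of
order at least 4, meets the centraliser of `P` nontrivially. As a 2-group, T centralises some
nontrivial element of that intersection, and T and `P` generate N. -/
theorem exists_involution_commute_normalizer {P : Sylow 7 G} {k : ℕ}
    (hP : Nat.card (P : Subgroup G) = 7)
    (hN : Nat.card (Subgroup.normalizer (P : Set G)) = 14 * 2 ^ (k + 1)) :
    ∃ t : G, t ≠ 1 ∧ t ^ 2 = 1 ∧ ∀ n ∈ Subgroup.normalizer (P : Set G), n * t = t * n := by
  have : Fact (Nat.Prime 7) := ⟨by norm_num⟩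
  let N := Subgroup.normalizer (P : Set G)
  let ψ : N →* MulAut (P : Subgroup G) := (P : Subgroup G).normalizerMonoidHom
  have h3 : ¬ 3 ∣ Nat.card (Subgroup.normalizer (P : Set G)) := by
    rw [hN]
    intro h
    have h1 : 3 ∣ 14 :=
      (Nat.Coprime.pow_right (k + 1) (by norm_num : Nat.Coprime 3 2)).dvd_of_dvd_mul_right h
    omega
  have hψ : ∀ g, ψ g ^ 2 = 1 := normalizerMonoidHom_sq hP h3
  obtain ⟨T⟩ : Nonempty (Sylow 2 N) := inferInstance
  have hT : Nat.card (T : Subgroup N) = 2 ^ (k + 2) :=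
    T.card_eq_of_card_eq (m := 7) (by rw [hN]; ring) (by norm_num)
  have hrange : Nat.card ψ.range ∣ 2 := by
    have h2 : IsPGroup 2 ψ.range := by
      rintro ⟨_, g, rfl⟩
      exact ⟨1, Subtype.ext (by simpa using hψ g)⟩
    obtain ⟨n, hn⟩ := h2.exists_card_eq
    have := isCyclic_of_prime_card hP
    have h6 : Nat.card (MulAut (P : Subgroup G)) = 6 := by
      rw [IsCyclic.card_mulAut, hP]; rfl
    have h7 := ψ.range.card_subgroup_dvd_card
    rw [h6, hn] at h7
    rw [hn]
    exact (Nat.Coprime.pow_left n (by norm_num : Nat.Coprime 2 3)).dvd_of_dvd_mul_left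
      (show 2 ^ n ∣ 3 * 2 from h7)
  have hH : 2 ∣ Nat.card ((T : Subgroup N) ⊓ ψ.ker : Subgroup N) := by
    have h1 := Subgroup.relIndex_mul_relIndex ⊥ ((T : Subgroup N) ⊓ ψ.ker) T bot_le inf_le_left
    rw [Subgroup.relIndex_bot_left, Subgroup.relIndex_bot_left, Subgroup.inf_relIndex_left, hT] at h1
    have h2 : ψ.ker.relIndex (T : Subgroup N) ∣ 2 :=
      (Subgroup.relIndex_dvd_index_of_normal _ _).trans (by rwa [Subgroup.index_ker])
    rcases (Nat.dvd_prime Nat.prime_two).1 h2 with h | h <;> rw [h] at h1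
    · exact ⟨2 ^ (k + 1), by rw [pow_succ'] at h1; omega⟩
    · exact ⟨2 ^ k, by rw [pow_succ', pow_succ'] at h1; omega⟩
  have hconj : ∀ a ∈ (T : Subgroup N), ∀ b ∈ (T : Subgroup N) ⊓ ψ.ker,
      a * b * a⁻¹ ∈ (T : Subgroup N) ⊓ ψ.ker := by
    intro a ha b hb
    have h1 : a * b * a⁻¹ ∈ (T : Subgroup N) := mul_mem (mul_mem ha hb.1) (inv_mem ha)
    exact ⟨h1, ψ.normal_ker.conj_mem b hb.2 a⟩
  obtain ⟨h, hh, hh1, hhT⟩ := Subgroup.exists_commute_of_le_normalizer (p := 2)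
    (P := (T : Subgroup N)) (H := (T : Subgroup N) ⊓ ψ.ker) T.2
    (by
      intro a ha
      refine Subgroup.mem_normalizer_iff.2 fun b => ⟨hconj a ha b, fun hb => ?_⟩
      have := hconj a⁻¹ (inv_mem ha) _ hb
      rwa [show a⁻¹ * (a * b * a⁻¹) * a⁻¹⁻¹ = b by group] at this)
    (by unfold Nat.ModEq; omega)
  have hhP : ∀ a ∈ P, a * (h : G) = h * a := by
    intro a ha
    have h1 := DFunLike.congr_fun (MonoidHom.mem_ker.1 hh.2) ⟨a, ha⟩
    have h2 : (h : G) * a * (h : G)⁻¹ = a := congrArg Subtype.val h1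
    exact (mul_inv_eq_iff_eq_mul.1 h2).symm
  have htop : (T : Subgroup N) ⊔ (P : Subgroup G).subgroupOf N = ⊤ := by
    apply Subgroup.eq_top_of_card_eq
    refine Nat.dvd_antisymm (Subgroup.card_subgroup_dvd_card _) ?_
    rw [hN, show 14 * 2 ^ (k + 1) = 2 ^ (k + 2) * 7 by ring]
    refine Nat.Coprime.mul_dvd_of_dvd_of_dvd (Nat.Coprime.pow_left _ (by norm_num)) ?_ ?_
    · rw [← hT]; exact Subgroup.card_dvd_of_le le_sup_left
    · have h1 : Nat.card ((P : Subgroup G).subgroupOf N) = 7 :=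
        (Nat.card_congr (Subgroup.subgroupOfEquivOfLe Subgroup.le_normalizer).toEquiv).trans hP
      have h2 := Subgroup.card_dvd_of_le
        (le_sup_right : (P : Subgroup G).subgroupOf N ≤ (T : Subgroup N) ⊔ _)
      rwa [h1] at h2
  have hcent : ∀ n : N, n * h = h * n := by
    have h1 : (T : Subgroup N) ⊔ (P : Subgroup G).subgroupOf N ≤ Subgroup.centralizer {h} := by
      refine sup_le (fun a ha => ?_) (fun a ha => ?_)
      · exact Subgroup.mem_centralizer_singleton_iff.2 (hhT a ha)
      · exact Subgroup.mem_centralizer_singleton_iff.2 (Subtype.ext (hhP a ha))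
    rw [htop] at h1
    exact fun n => Subgroup.mem_centralizer_singleton_iff.1 (h1 (Subgroup.mem_top n))
  have h2 : 2 ∣ orderOf h := by
    obtain ⟨m, hm⟩ := T.2 ⟨h, hh.1⟩
    have hm' : h ^ 2 ^ m = 1 := congrArg Subtype.val hm
    obtain ⟨j, -, hj⟩ := (Nat.dvd_prime_pow Nat.prime_two).1 (orderOf_dvd_of_pow_eq_one hm')
    rcases j with _ | j
    · exact absurd (orderOf_eq_one_iff.1 (by simpa using hj)) hh1
    · rw [hj, pow_succ]; exact dvd_mul_left _ _
  obtain ⟨m, hm⟩ := h2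
  refine ⟨(h : G) ^ m, ?_, ?_, fun n hn => ?_⟩
  · intro h4
    have h5 : orderOf h ∣ m := orderOf_dvd_of_pow_eq_one (Subtype.ext h4)
    have h6 := orderOf_pos h
    have h7 := Nat.le_of_dvd (by omega) h5
    omega
  · rw [← pow_mul, mul_comm, ← hm]
    exact congrArg Subtype.val (pow_orderOf_eq_one h)
  · exact (show Commute n (h : G) from congrArg Subtype.val (hcent ⟨n, hn⟩)).pow_right m

end Sylow

/-! ### Central quotients of perfect groups -/

theorem commutator_quotient_eq_top {G : Type*} [Group G] (hG : commutator G = ⊤)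
    (N : Subgroup G) [N.Normal] : commutator (G ⧸ N) = ⊤ := by
  have h := Subgroup.map_commutator (⊤ : Subgroup G) ⊤ (QuotientGroup.mk' N)
  rw [Subgroup.map_top_of_surjective _ (QuotientGroup.mk'_surjective N), ← commutator_def, hG,
    Subgroup.map_top_of_surjective _ (QuotientGroup.mk'_surjective N), ← commutator_def] at h
  exact h.symm

/-- Commutation with `a` is a homomorphism into the abelian group `N`, hence trivial. -/
theorem mem_center_of_quotient {G : Type*} [Group G] (hG : commutator G = ⊤)
    {N : Subgroup G} (hN : N ≤ Subgroup.center G) {a : G} (ha : ∀ g, a * g * a⁻¹ * g⁻¹ ∈ N) :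
    a ∈ Subgroup.center G := by
  let f : G →* N :=
    { toFun g := ⟨a * g * a⁻¹ * g⁻¹, ha g⟩
      map_one' := Subtype.ext (by simp)
      map_mul' g g' := by
        apply Subtype.ext
        have h1 := Subgroup.mem_center_iff.1 (hN (ha g')) g
        change a * (g * g') * a⁻¹ * (g * g')⁻¹ = a * g * a⁻¹ * g⁻¹ * (a * g' * a⁻¹ * g'⁻¹)
        calc _ = a * g * a⁻¹ * g⁻¹ * (g * (a * g' * a⁻¹ * g'⁻¹) * g⁻¹) := by group
          _ = _ := by rw [h1]; group }
  rw [Subgroup.mem_center_iff]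
  intro g
  have h1 := MonoidHom.map_eq_one_of_commutator_eq_top
    (fun b c => Subtype.ext (Subgroup.mem_center_iff.1 (hN c.2) b)) hG f g
  have h2 : a * g * a⁻¹ * g⁻¹ = 1 := congrArg Subtype.val h1
  rw [mul_inv_eq_one, mul_inv_eq_iff_eq_mul] at h2
  exact h2.symm

namespace Sylow

/-- Elements of two Sylow subgroups with equal image differ by a central element whose order divides
both p and the order of `N`. -/
theorem card_quotient_of_central {G : Type*} [Group G] [Finite G] {p : ℕ} [hp : Fact p.Prime]
    {N : Subgroup G} [N.Normal] (hN : N ≤ Subgroup.center G) (hNp : (Nat.card N).Coprime p)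
    (hcard : ∀ P : Sylow p G, Nat.card (P : Subgroup G) = p) :
    Nat.card (Sylow p (G ⧸ N)) = Nat.card (Sylow p G) := by
  symm
  refine Nat.card_eq_of_bijective _
    ⟨fun P P' h => ?_, mapSurjective_surjective (QuotientGroup.mk'_surjective N) p⟩
  have h1 := congrArg (fun A : Sylow p (G ⧸ N) => (A : Subgroup (G ⧸ N))) h
  simp only [coe_mapSurjective] at h1
  apply Sylow.ext
  refine Subgroup.eq_of_le_of_card_ge (fun a ha => ?_) (by rw [hcard, hcard])
  have h2 : (a : G ⧸ N) ∈ (P' : Subgroup G).map (QuotientGroup.mk' N) := by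
    rw [← h1]; exact ⟨a, ha, rfl⟩
  obtain ⟨b, hb, hba⟩ := h2
  have h3 : b⁻¹ * a ∈ N := QuotientGroup.eq.1 hba
  have h4 : (b⁻¹ * a) ^ p = 1 := by
    have hc : a = b * (b⁻¹ * a) := by group
    have hcomm : Commute b (b⁻¹ * a) := Subgroup.mem_center_iff.1 (hN h3) b
    have h5 := Subgroup.pow_eq_one_of_card_eq (hcard P) ha
    rw [hc, hcomm.mul_pow, Subgroup.pow_eq_one_of_card_eq (hcard P') hb, one_mul] at h5
    exact h5
  have h6 : b⁻¹ * a = 1 := by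
    apply orderOf_eq_one_iff.1
    exact Nat.eq_one_of_dvd_coprimes hNp
      (orderOf_dvd_of_pow_eq_one (Subgroup.pow_eq_one_of_card_eq rfl h3))
      (orderOf_dvd_of_pow_eq_one h4)
  rw [inv_mul_eq_one] at h6
  exact h6 ▸ hb

end Sylow

theorem eq_one_of_pow_coprime {G : Type*} [Group G] {g : G} {m n : ℕ} (hm : g ^ m = 1)
    (hn : g ^ n = 1) (h : m.Coprime n) : g = 1 :=
  orderOf_eq_one_iff.1 (Nat.eq_one_of_dvd_coprimes h (orderOf_dvd_of_pow_eq_one hm)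
    (orderOf_dvd_of_pow_eq_one hn))

theorem Subgroup.mul_mem_iff_of_card_eq_two_mul {G : Type*} [Group G] [Finite G]
    {H N : Subgroup G} (hHN : H ≤ N) (hc : Nat.card N = 2 * Nat.card H) {a b : G} (ha : a ∈ N)
    (hb : b ∈ N) : a * b ∈ H ↔ (a ∈ H ↔ b ∈ H) := by
  have h1 : (H.subgroupOf N).index = 2 := by
    have h2 := Subgroup.card_mul_index (H.subgroupOf N)
    rw [Nat.card_congr (Subgroup.subgroupOfEquivOfLe hHN).toEquiv, hc, mul_comm 2] at h2
    exact Nat.eq_of_mul_eq_mul_left Nat.card_pos h2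
  exact Subgroup.mul_mem_iff_of_index_two h1 (a := ⟨a, ha⟩) (b := ⟨b, hb⟩)

theorem mem_normalizer_zpowers {G : Type*} [Group G] {g d : G}
    (h : g * d * g⁻¹ = d ∨ g * d * g⁻¹ = d⁻¹) :
    g ∈ Subgroup.normalizer (Subgroup.zpowers d : Set G) := by
  have key : ∀ g : G, g * d * g⁻¹ = d ∨ g * d * g⁻¹ = d⁻¹ → ∀ b ∈ Subgroup.zpowers d,
      g * b * g⁻¹ ∈ Subgroup.zpowers d := by
    rintro g h _ ⟨k, rfl⟩
    change g * d ^ k * g⁻¹ ∈ _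
    rw [← conj_zpow]
    rcases h with h | h <;> rw [h]
    · exact zpow_mem (Subgroup.mem_zpowers d) k
    · exact zpow_mem (inv_mem (Subgroup.mem_zpowers d)) k
  refine Subgroup.mem_normalizer_iff.2 fun b => ⟨key g h b, fun hb => ?_⟩
  have h1 : g⁻¹ * d * g⁻¹⁻¹ = d ∨ g⁻¹ * d * g⁻¹⁻¹ = d⁻¹ := by
    rcases h with h | h
    · left; nth_rw 1 [← h]; group
    · right
      calc g⁻¹ * d * g⁻¹⁻¹ = (g⁻¹ * d⁻¹ * g)⁻¹ := by group
        _ = (g⁻¹ * (g * d * g⁻¹) * g)⁻¹ := by rw [h]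
        _ = d⁻¹ := by group
  have h2 := key g⁻¹ h1 _ hb
  rwa [show g⁻¹ * (g * b * g⁻¹) * g⁻¹⁻¹ = b by group] at h2

theorem ncard_isConj_mul_card_centralizer {G : Type*} [Group G] [Finite G] (v : G) :
    Nat.card (Subgroup.centralizer {v}) * {g : G | IsConj g v}.ncard = Nat.card G := by
  have h1 := Subgroup.card_mul_index (stabilizer (ConjAct G) v)
  rw [index_stabilizer] at h1
  have h2 : orbit (ConjAct G) v = {g : G | IsConj g v} := by
    ext g; exact ConjAct.mem_orbit_conjAct
  rw [h2] at h1
  have h3 : Nat.card (stabilizer (ConjAct G) v) = Nat.card (Subgroup.centralizer {v}) := by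
    rw [ConjAct.stabilizer_eq_centralizer]; rfl
  rw [← h3, h1]; rfl

/-! ### Perfect groups of order 504 -/

namespace Sylow

variable {G : Type*} [Group G] [Finite G]

theorem le_ncard_of_disjoint {p m : ℕ} [Fact p.Prime]
    (hcard : ∀ Q : Sylow p G, Nat.card (Q : Subgroup G) = m + 1)
    (hTI : ∀ Q Q' : Sylow p G, ∀ d, d ∈ Q → d ∈ Q' → d ≠ 1 → Q = Q') :
    Nat.card (Sylow p G) * m ≤ {g : G | g ≠ 1 ∧ ∃ Q : Sylow p G, g ∈ Q}.ncard := by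
  have := Fintype.ofFinite (Sylow p G)
  have h1 : Nat.card (Σ Q : Sylow p G, {g : G | g ≠ 1 ∧ g ∈ Q}) = Nat.card (Sylow p G) * m := by
    rw [Nat.card_sigma, Finset.sum_const_nat (m := m), Nat.card_eq_fintype_card, Finset.card_univ]
    intro Q _
    have h2 : insert 1 {g : G | g ≠ 1 ∧ g ∈ Q} = (Q : Set G) := by
      ext g
      by_cases hg : g = 1
      · simp [hg, one_mem]
      · simp [hg]
    have h3 := Set.ncard_insert_of_notMem (a := (1 : G)) (s := {g : G | g ≠ 1 ∧ g ∈ Q})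
      (fun h => h.1 rfl)
    rw [h2] at h3
    have h4 : (Q : Set G).ncard = m + 1 := hcard Q
    rw [Nat.card_coe_set_eq]
    omega
  rw [← h1, ← Nat.card_coe_set_eq]
  refine Nat.card_le_card_of_injective
    (fun q => (⟨q.2, q.2.2.1, q.1, q.2.2.2⟩ : {g : G | g ≠ 1 ∧ ∃ Q : Sylow p G, g ∈ Q})) ?_
  rintro ⟨Q, g, hg⟩ ⟨Q', g', hg'⟩ h
  have h5 : g = g' := congrArg Subtype.val h
  subst h5
  have h6 := hTI Q Q' g hg.2 hg'.2 hg.1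
  subst h6
  rfl

/-- In a perfect group of order `504` with `36` Sylow `7`-subgroups there are no elements of
order `4`. -/
theorem sq_eq_one_of_card_eq_504 (hG : commutator G = ⊤) (hc : Nat.card G = 504)
    (h36 : Nat.card (Sylow 7 G) = 36) {w : G} (hw : w ^ 4 = 1) : w ^ 2 = 1 := by
  have f7 : Fact (Nat.Prime 7) := ⟨by norm_num⟩
  have f3 : Fact (Nat.Prime 3) := ⟨by norm_num⟩
  -- The plan is a count: 28·8 elements from Sylow 3-subgroups, 36·6 from Sylow 7-subgroups, at
  -- least 63 involutions and the identity already make 504, leaving no room for `w`.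
  by_contra hw2
  have hcard : ∀ P : Sylow 7 G, Nat.card (P : Subgroup G) = 7 := fun P => by
    simpa using P.card_eq_of_card_eq (n := 1) (m := 72) (by rw [hc]; norm_num) (by norm_num)
  have hcardN : ∀ P : Sylow 7 G, Nat.card (Subgroup.normalizer (P : Set G)) = 14 := fun P => by
    have h9 := Subgroup.card_mul_index (Subgroup.normalizer (P : Set G))
    rw [← card_eq_index_normalizer, h36, hc] at h9
    omega
  have hexinv := fun P : Sylow 7 G =>
    exists_inv hG (hcard P) (by rw [hcardN]; norm_num)
  obtain ⟨P⟩ : Nonempty (Sylow 7 G) := inferInstance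
  have hnt : ∀ P : Sylow 7 G, ∃ e ∈ P, e ≠ 1 := by
    intro P
    have : Nontrivial (P : Subgroup G) := by
      rw [← Finite.one_lt_card_iff_nontrivial, hcard]; norm_num
    obtain ⟨e, hne⟩ := exists_ne (1 : (P : Subgroup G))
    exact ⟨e, e.2, fun h => hne (Subtype.ext h)⟩
  have hnotcomm : ∀ (P : Sylow 7 G) (v : G), (∀ a ∈ P, v * a = a⁻¹ * v) →
      ¬ ∀ a ∈ P, v * a = a * v := by
    intro P v hv hcomm
    obtain ⟨e, he, hne⟩ := hnt P
    have h1 := (hv e he).symm.trans (hcomm e he)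
    rw [mul_left_inj, inv_eq_iff_mul_eq_one, ← pow_two] at h1
    exact hne (eq_one_of_pow_coprime h1 (Subgroup.pow_eq_one_of_card_eq (hcard P) he) (by norm_num))
  -- `P` has index 2 in its normaliser, so if `c` and an inverting `v` both lie outside `P`, then `c
  -- * v` lies in it, and `v` would commute with `P`.
  have hself : ∀ (P : Sylow 7 G) (c : G), (∀ a ∈ P, a * c = c * a) → c ∈ P := by
    intro P c hcP
    by_contra hcn
    obtain ⟨v, hvN, hv⟩ := hexinv P
    have hcomm := commute_of_card_prime (hcard P)
    have hcN : c ∈ Subgroup.normalizer (P : Set G) := by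
      refine Subgroup.mem_normalizer_iff.2 fun a => ⟨fun ha => ?_, fun ha => ?_⟩
      · change a ∈ P at ha
        rwa [← hcP a ha, mul_inv_cancel_right]
      · have h1 := hcP _ ha
        rw [inv_mul_cancel_right, mul_right_inj] at h1
        rwa [← h1] at ha
    have hvn : v ∉ P := fun h => hnotcomm P v hv (fun a ha => hcomm v h a ha)
    have h1 : c * v ∈ (P : Subgroup G) := by
      rw [Subgroup.mul_mem_iff_of_card_eq_two_mul Subgroup.le_normalizer
        (show Nat.card (Subgroup.normalizer (P : Set G)) = 2 * Nat.card (P : Subgroup G) by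
          rw [hcardN, hcard]) hcN hvN]
      exact ⟨fun h => absurd h hcn, fun h => absurd h hvn⟩
    refine hnotcomm P v hv (fun a ha => ?_)
    have h2 := hcomm _ h1 a ha
    rwa [mul_assoc, ← mul_assoc a, hcP a ha, mul_assoc, mul_right_inj] at h2
  have hno : ∀ (P : Sylow 7 G) (H : Subgroup G), ¬ 7 ∣ Nat.card H → ¬ Nat.card H ≡ 1 [MOD 7] →
      ¬ (P : Subgroup G) ≤ Subgroup.normalizer (H : Set G) := by
    intro P H h7 h1 hle
    obtain ⟨h, hh, hh1, hcomm⟩ := Subgroup.exists_commute_of_le_normalizer P.2 hle h1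
    have h2 := Subgroup.pow_eq_one_of_card_eq (hcard P) (hself P h hcomm)
    exact hh1 (eq_one_of_pow_coprime h2 (Subgroup.pow_eq_one_of_card_eq rfl hh)
      ((Nat.Prime.coprime_iff_not_dvd (by norm_num)).2 h7))
  have hzp : ∀ g : G, orderOf g = 7 → ∃ P : Sylow 7 G, (P : Subgroup G) = Subgroup.zpowers g := by
    intro g hg
    have h1 : Nat.card (Subgroup.zpowers g) = 7 ^ 1 := by rw [Nat.card_zpowers, hg]; norm_num
    obtain ⟨P, hP⟩ := (IsPGroup.of_card h1).exists_le_sylow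
    exact ⟨P, (Subgroup.eq_of_le_of_card_ge hP (by rw [h1, hcard]; norm_num)).symm⟩
  have hcauchy : ∀ H : Subgroup G, 7 ∣ Nat.card H → ∃ P : Sylow 7 G, (P : Subgroup G) ≤ H := by
    intro H h7
    obtain ⟨g, hg⟩ := exists_prime_orderOf_dvd_card' 7 h7
    obtain ⟨P, hP⟩ := hzp g (by rw [Subgroup.orderOf_coe, hg])
    exact ⟨P, by rw [hP]; simp⟩
  have hcent7 : ∀ d : G, d ≠ 1 → d ^ 72 = 1 → ¬ 7 ∣ Nat.card (Subgroup.centralizer {d}) := by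
    intro d hd1 hd h7
    obtain ⟨P, hP⟩ := hcauchy _ h7
    have h1 := hself P d (fun a ha => Subgroup.mem_centralizer_singleton_iff.1 (hP ha))
    exact hd1 (eq_one_of_pow_coprime hd (Subgroup.pow_eq_one_of_card_eq (hcard P) h1) (by norm_num))
  obtain ⟨v, hv1, hv2, hvP⟩ : ∃ v : G, v ≠ 1 ∧ v ^ 2 = 1 ∧ ∀ a ∈ P, v * a = a⁻¹ * v := by
    obtain ⟨v, hvN, hv⟩ := hexinv P
    have h1 : ∀ a ∈ P, v ^ 7 * a = a⁻¹ * v ^ 7 := by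
      intro a ha
      have h2 : Commute (v ^ 2) a := by
        change v ^ 2 * a = a * v ^ 2
        rw [pow_two, mul_assoc, hv a ha, ← mul_assoc, hv _ (inv_mem ha), inv_inv, mul_assoc]
      have h3 : v ^ 7 = v * (v ^ 2) ^ 3 := by rw [← pow_mul, ← pow_succ']
      rw [h3, mul_assoc, (h2.pow_left 3).eq, ← mul_assoc, hv a ha, mul_assoc]
    -- The normaliser has order 14, so a seventh power has square 1; an odd power still inverts `P`.
    refine ⟨v ^ 7, fun h => hnotcomm P 1 ?_ (by simp), ?_, h1⟩
    · rwa [h] at h1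
    · rw [← pow_mul]; exact Subgroup.pow_eq_one_of_card_eq (hcardN P) hvN
  have hodd : ∀ a ∈ (P : Subgroup G), a ^ 2 = 1 → a = 1 := fun a ha h =>
    eq_one_of_pow_coprime h (Subgroup.pow_eq_one_of_card_eq (hcard P) ha) (by norm_num)
  -- On 7 points with `P` free, `v` fixes at most one point, while parity demands 3 modulo 4.
  have seven : ∀ (X : Type _) [MulAction G X] [Finite X],
      (∀ a ∈ P, a ≠ 1 → ∀ u : X, a • u ≠ u) → Nat.card X ≠ 7 := by
    intro X _ _ hfree hX
    have h1 := card_mul_card_fixed_le (P := (P : Subgroup G)) (t := v) hodd hvP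
      (Y := (Set.univ : Set X)) (F := fixedBy X v)
      (fun a ha u _ => ⟨trivial, fun h => by_contra fun h1 => hfree a ha h1 u h⟩)
      (Set.subset_univ _) (fun u hu => hu)
    have h2 := card_fixedBy_mod_four (X := X) (MonoidHom.eq_one_of_commutator_eq_top hG) hv2
    have h3 : Nat.card (Set.univ : Set X) = 7 := by
      rw [Nat.card_coe_set_eq, Set.ncard_univ, hX]
    rw [hcard, h3] at h1
    rw [hX] at h2
    omega
  have hindex : ∀ M : Subgroup G, Nat.card M ≠ 72 := by
    intro M hM
    apply seven (G ⧸ M)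
    · intro a ha ha1 u hu
      induction u using QuotientGroup.induction_on with
      | H g =>
        have h1 : g⁻¹ * (a * g) ∈ M := QuotientGroup.eq.1 hu.symm
        have h2 := Subgroup.pow_eq_one_of_card_eq hM h1
        have h3 : (g⁻¹ * a * g⁻¹⁻¹) ^ 72 = 1 := by rwa [inv_inv, mul_assoc]
        rw [conj_pow, conj_eq_one_iff] at h3
        exact ha1 (eq_one_of_pow_coprime h3 (Subgroup.pow_eq_one_of_card_eq (hcard P) ha)
          (by norm_num))
    · have := Subgroup.card_eq_card_quotient_mul_card_subgroup M
      rw [hc, hM] at this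
      omega
  have hQ : ∀ Q : Sylow 3 G, Nat.card (Q : Subgroup G) = 9 := fun Q =>
    Q.card_eq_of_card_eq (n := 2) (m := 56) (by rw [hc]; norm_num) (by norm_num)
  have hPfree : ∀ a ∈ P, a ≠ 1 → ∀ Q : Sylow 3 G, a • Q ≠ Q := by
    intro a ha ha1 Q hfix
    refine hno P Q (by rw [hQ]; norm_num) (by rw [hQ]; decide) ?_
    have h1 : orderOf a = 7 :=
      orderOf_eq_prime (Subgroup.pow_eq_one_of_card_eq (hcard P) ha) ha1
    obtain ⟨P', hP'⟩ := hzp a h1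
    have h2 : (P' : Subgroup G) = P :=
      Subgroup.eq_of_card_eq_prime (hcard P') (hcard P) (hP' ▸ Subgroup.mem_zpowers a) ha ha1
    rw [← h2, hP', Subgroup.zpowers_le]
    exact smul_eq_iff_mem_normalizer.1 hfix
  -- The number divides 56, is 1 modulo 3, and is a multiple of 7 because `P` acts freely. This
  -- leaves 7 and 28, and `seven` excludes 7.
  have h28 : Nat.card (Sylow 3 G) = 28 := by
    obtain ⟨Q⟩ : Nonempty (Sylow 3 G) := inferInstance
    have h1 : Nat.card (Sylow 3 G) ∣ 56 := by
      have h2 := Q.card_dvd_index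
      have h3 := Subgroup.card_mul_index (Q : Subgroup G)
      rw [hQ, hc] at h3
      rwa [show (Q : Subgroup G).index = 56 by omega] at h2
    have h2 : Nat.card (Sylow 3 G) ≡ 1 [MOD 3] := card_sylow_modEq_one 3 G
    have h3 := P.2.card_modEq_card_fixedPoints (Sylow 3 G)
    have h4 : fixedPoints (P : Subgroup G) (Sylow 3 G) = ∅ := by
      rw [Set.eq_empty_iff_forall_notMem]
      intro Q hQ
      obtain ⟨e, he, hne⟩ := hnt P
      exact hPfree e he hne Q (hQ ⟨e, he⟩)
    rw [h4, Nat.card_coe_set_eq, Set.ncard_empty] at h3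
    have h5 := seven (Sylow 3 G) hPfree
    have h6 : Nat.card (Sylow 3 G) ∈ Nat.divisors 56 := Nat.mem_divisors.2 ⟨h1, by norm_num⟩
    rw [show Nat.divisors 56 = {1, 2, 4, 7, 8, 14, 28, 56} by decide] at h6
    simp only [Finset.mem_insert, Finset.mem_singleton] at h6
    unfold Nat.ModEq at h2 h3
    omega
  have hQN : ∀ Q : Sylow 3 G, Nat.card (Subgroup.normalizer (Q : Set G)) = 18 := fun Q => by
    have h9 := Subgroup.card_mul_index (Subgroup.normalizer (Q : Set G))
    rw [← card_eq_index_normalizer, h28, hc] at h9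
    omega
  have hQcomm : ∀ Q : Sylow 3 G, ∀ a ∈ Q, ∀ b ∈ Q, a * b = b * a := by
    intro Q a ha b hb
    have := IsPGroup.isMulCommutative_of_card_eq_prime_sq (p := 3) (G := (Q : Subgroup G)) (hQ Q)
    exact congrArg Subtype.val (this.is_comm.comm ⟨a, ha⟩ ⟨b, hb⟩)
  -- The product `q * (n * q * n⁻¹)` is centralised by `n` and `Q`, hence by the whole normaliser,
  -- so transfer kills it.
  have hQinv : ∀ (Q : Sylow 3 G), ∀ n ∈ Subgroup.normalizer (Q : Set G), n ∉ Q →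
      ∀ q ∈ Q, n * q * n⁻¹ = q⁻¹ := by
    intro Q n hn hnQ q hq
    have hiff := fun {a b : G} => Subgroup.mul_mem_iff_of_card_eq_two_mul (a := a) (b := b)
      (H := (Q : Subgroup G)) Subgroup.le_normalizer
      (show Nat.card (Subgroup.normalizer (Q : Set G)) = 2 * Nat.card (Q : Subgroup G) by
        rw [hQN, hQ])
    have hconj : n * q * n⁻¹ ∈ Q := (Subgroup.mem_normalizer_iff.1 hn q).1 hq
    have hnn : n * n ∈ Q := (hiff hn hn).2 Iff.rfl
    have he : q * (n * q * n⁻¹) ∈ Q := mul_mem hq hconj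
    have hne : n * (q * (n * q * n⁻¹)) = q * (n * q * n⁻¹) * n := by
      have h1 := hQcomm Q _ hnn _ hq
      calc n * (q * (n * q * n⁻¹)) = n * q * n⁻¹ * (n * n * q) * n⁻¹ := by group
        _ = (n * q * n⁻¹) * q * n := by rw [h1]; group
        _ = _ := by rw [hQcomm Q _ hconj _ hq]
    refine eq_inv_of_mul_eq_one_right (Q.eq_one_of_commute_normalizer (hQcomm Q)
      (MonoidHom.map_eq_one_of_commutator_eq_top
        (fun a b => Subtype.ext (hQcomm Q a a.2 b b.2)) hG) he (fun m hm => ?_))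
    by_cases hmQ : m ∈ Q
    · exact hQcomm Q _ hmQ _ he
    · have h1 : n⁻¹ * m ∈ Q := (hiff (inv_mem hn) hm).2
        ⟨fun h => absurd (inv_mem_iff.1 h) hnQ, fun h => absurd h hmQ⟩
      have h2 := hQcomm Q _ h1 _ he
      have h3 : m = n * (n⁻¹ * m) := by group
      rw [h3, mul_assoc, h2, ← mul_assoc, hne, mul_assoc]
  -- If `d` is shared, its centraliser has 4 Sylow 3-subgroups and order divisible by 36. The
  -- normaliser of the subgroup generated by `d` is strictly larger and of order prime to 7, so it
  -- has order 72, excluded by `hindex`.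
  have hTI : ∀ Q Q' : Sylow 3 G, ∀ d, d ∈ Q → d ∈ Q' → d ≠ 1 → Q = Q' := by
    intro Q Q' d hd hd' hd1
    by_contra hne
    have hd9 : d ^ 9 = 1 := Subgroup.pow_eq_one_of_card_eq (hQ Q) hd
    let C := Subgroup.centralizer {d}
    have hC7 : ¬ 7 ∣ Nat.card C := hcent7 d hd1 (by
      rw [show 72 = 9 * 8 from rfl, pow_mul, hd9, one_pow])
    have hle : ∀ A : Sylow 3 G, d ∈ A → (A : Subgroup G) ≤ C := fun A hA a ha =>
      Subgroup.mem_centralizer_singleton_iff.2 (hQcomm A a ha d hA)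
    have hCdvd : Nat.card C ∣ 504 := hc ▸ C.card_subgroup_dvd_card
    have h36C : 36 ∣ Nat.card C := by
      have h1 : Nat.card ((Q.subtype (hle Q hd) : Sylow 3 C) : Subgroup C) = 9 :=
        (Nat.card_congr (Subgroup.subgroupOfEquivOfLe (hle Q hd)).toEquiv).trans (hQ Q)
      have h2 := Subgroup.card_mul_index ((Q.subtype (hle Q hd) : Sylow 3 C) : Subgroup C)
      have h3 := (Q.subtype (hle Q hd)).card_dvd_index
      have h4 : Nat.card (Sylow 3 C) ≡ 1 [MOD 3] := card_sylow_modEq_one 3 C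
      have h5 : Nat.card (Sylow 3 C) ≠ 1 := by
        intro h
        have := (Nat.card_eq_one_iff_unique.1 h).1
        exact hne (subtype_injective (hP := hle Q hd) (hQ := hle Q' hd')
          (Subsingleton.elim _ _))
      rw [h1] at h2
      generalize ((Q.subtype (hle Q hd) : Sylow 3 C) : Subgroup C).index = j at *
      rw [← h2] at hC7 hCdvd ⊢
      have h6 : j ∣ 8 := by
        have h7 : j ∣ 56 := Nat.dvd_of_mul_dvd_mul_left (by norm_num : 0 < 9) hCdvd
        refine Nat.Coprime.dvd_of_dvd_mul_left (m := 7) ?_ h7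
        rw [Nat.coprime_comm, Nat.Prime.coprime_iff_not_dvd (by norm_num)]
        exact fun h => hC7 (h.mul_left 9)
      have h8 : Nat.card (Sylow 3 C) ∈ Nat.divisors 8 :=
        Nat.mem_divisors.2 ⟨h3.trans h6, by norm_num⟩
      rw [show Nat.divisors 8 = {1, 2, 4, 8} by decide] at h8
      simp only [Finset.mem_insert, Finset.mem_singleton] at h8
      unfold Nat.ModEq at h4
      have h9 : Nat.card (Sylow 3 C) = 4 := by omega
      rw [h9] at h3
      exact mul_dvd_mul_left 9 h3
    obtain ⟨n, hn, hnQ⟩ : ∃ n ∈ Subgroup.normalizer (Q : Set G), n ∉ (Q : Subgroup G) := by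
      by_contra! hcon
      have h1 := Subgroup.card_le_of_le (H := Subgroup.normalizer (Q : Set G)) hcon
      rw [hQN, hQ] at h1
      omega
    let M := Subgroup.normalizer (Subgroup.zpowers d : Set G)
    have hninv := hQinv Q n hn hnQ d hd
    have hnM : n ∈ M := mem_normalizer_zpowers (Or.inr hninv)
    have hCM : C < M := by
      refine lt_of_le_of_ne ?_ ?_
      · intro g hg
        refine mem_normalizer_zpowers (Or.inl ?_)
        rw [Subgroup.mem_centralizer_singleton_iff.1 hg, mul_inv_cancel_right]
      · intro h
        rw [← h] at hnM
        have h1 := Subgroup.mem_centralizer_singleton_iff.1 hnM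
        rw [mul_inv_eq_iff_eq_mul, h1, mul_left_inj, eq_inv_iff_mul_eq_one, ← pow_two] at hninv
        exact hd1 (eq_one_of_pow_coprime hninv hd9 (by norm_num))
    have hM7 : ¬ 7 ∣ Nat.card M := by
      intro h7
      obtain ⟨P', hP'⟩ := hcauchy M h7
      have h1 : orderOf d ∣ 3 ^ 2 := orderOf_dvd_of_pow_eq_one hd9
      obtain ⟨m, hm, hm'⟩ := (Nat.dvd_prime_pow Nat.prime_three).1 h1
      refine hno P' (Subgroup.zpowers d) ?_ ?_ hP' <;> rw [Nat.card_zpowers, hm']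
      · interval_cases m <;> norm_num
      · interval_cases m
        · exact absurd (orderOf_eq_one_iff.1 hm') hd1
        · decide
        · decide
    apply hindex M
    have h1 : Nat.card C ∣ Nat.card M := Subgroup.card_dvd_of_le hCM.le
    have h2 : Nat.card C < Nat.card M := by
      refine lt_of_le_of_ne (Subgroup.card_le_of_le hCM.le) fun h => hCM.ne ?_
      exact Subgroup.eq_of_le_of_card_ge hCM.le h.ge
    have h3 : Nat.card M ∣ 72 := by
      refine Nat.Coprime.dvd_of_dvd_mul_left (m := 7) ?_ (show Nat.card M ∣ 7 * 72 from
        (hc ▸ M.card_subgroup_dvd_card : Nat.card M ∣ 504))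
      rw [Nat.coprime_comm, Nat.Prime.coprime_iff_not_dvd (by norm_num)]
      exact hM7
    have h4 : 36 ≤ Nat.card C := Nat.le_of_dvd Nat.card_pos h36C
    obtain ⟨r, hr⟩ := h3
    have h5 : r < 2 := by
      by_contra! h
      have : Nat.card M * 2 ≤ Nat.card M * r := Nat.mul_le_mul_left _ h
      omega
    interval_cases r <;> omega
  -- An element of order 3 commuting with `v` lies in a Sylow 3-subgroup which `v` must normalise by
  -- `hTI`, and so would be inverted by `v`.
  have hcv : Nat.card (Subgroup.centralizer {v}) ∣ 8 := by
    have h1 : Nat.card (Subgroup.centralizer {v}) ∣ 504 :=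
      hc ▸ Subgroup.card_subgroup_dvd_card _
    have h7 : ¬ 7 ∣ Nat.card (Subgroup.centralizer {v}) := hcent7 v hv1 (by
      rw [show 72 = 2 * 36 from rfl, pow_mul, hv2, one_pow])
    have h3 : ¬ 3 ∣ Nat.card (Subgroup.centralizer {v}) := by
      intro h3
      obtain ⟨⟨d, hd⟩, hdo⟩ := exists_prime_orderOf_dvd_card' 3 h3
      have hdo' : orderOf d = 3 := by rw [← hdo]; exact (Subgroup.orderOf_mk d hd).symm
      have hd3 : d ^ 3 = 1 := hdo' ▸ pow_orderOf_eq_one d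
      have hd1 : d ≠ 1 := by rintro rfl; simp at hdo'
      have hdv : d * v = v * d := Subgroup.mem_centralizer_singleton_iff.1 hd
      obtain ⟨Q, hQd⟩ := (IsPGroup.of_card (p := 3) (n := 1) (G := Subgroup.zpowers d)
        (by rw [Nat.card_zpowers, hdo']; norm_num)).exists_le_sylow
      have hdQ : d ∈ Q := hQd (Subgroup.mem_zpowers d)
      have hvd : v * d * v⁻¹ = d := by rw [← hdv, mul_inv_cancel_right]
      have hvQ : v • Q = Q := by
        refine hTI _ _ d ?_ hdQ hd1
        have h4 : v * d * v⁻¹ ∈ v • Q := ⟨d, hdQ, rfl⟩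
        rwa [hvd] at h4
      have h5 := hQinv Q v (smul_eq_iff_mem_normalizer.1 hvQ)
        (fun h => hv1 (eq_one_of_pow_coprime hv2
          (Subgroup.pow_eq_one_of_card_eq (hQ Q) h) (by norm_num))) d hdQ
      rw [hvd, eq_inv_iff_mul_eq_one, ← pow_two] at h5
      exact hd1 (eq_one_of_pow_coprime h5 hd3 (by norm_num))
    have h4 : (Nat.card (Subgroup.centralizer {v})).Coprime 63 := by
      rw [show 63 = 7 * 3 ^ 2 from rfl]
      refine Nat.Coprime.mul_right ?_ (Nat.Coprime.pow_right 2 ?_) <;>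
        rw [Nat.coprime_comm, Nat.Prime.coprime_iff_not_dvd (by norm_num)] <;> assumption
    exact h4.dvd_of_dvd_mul_left (show _ ∣ 63 * 8 from h1)
  have hSv : 63 ≤ {g : G | IsConj g v}.ncard := by
    have h1 := ncard_isConj_mul_card_centralizer v
    rw [hc] at h1
    have h2 := Nat.le_of_dvd (by norm_num) hcv
    by_contra! h3
    have : Nat.card (Subgroup.centralizer {v}) * {g : G | IsConj g v}.ncard ≤ 8 * 62 :=
      Nat.mul_le_mul h2 (by omega)
    omega
  have hS3 := le_ncard_of_disjoint (p := 3) (m := 8) hQ hTI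
  have hS7 := le_ncard_of_disjoint (p := 7) (m := 6) hcard (fun P P' d hd hd' hd1 =>
    Sylow.ext (Subgroup.eq_of_card_eq_prime (hcard P) (hcard P') hd hd' hd1))
  rw [h28] at hS3
  rw [h36] at hS7
  have h3pow : ∀ g ∈ {g : G | g ≠ 1 ∧ ∃ Q : Sylow 3 G, g ∈ Q}, g ≠ 1 ∧ g ^ 9 = 1 :=
    fun g ⟨h1, Q, hg⟩ => ⟨h1, Subgroup.pow_eq_one_of_card_eq (hQ Q) hg⟩
  have h7pow : ∀ g ∈ {g : G | g ≠ 1 ∧ ∃ Q : Sylow 7 G, g ∈ Q}, g ≠ 1 ∧ g ^ 7 = 1 :=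
    fun g ⟨h1, Q, hg⟩ => ⟨h1, Subgroup.pow_eq_one_of_card_eq (hcard Q) hg⟩
  have h2pow : ∀ g ∈ {g : G | IsConj g v}, g ≠ 1 ∧ g ^ 2 = 1 := by
    intro g hg
    obtain ⟨c, hc⟩ := isConj_iff.1 hg
    have h2 : c * g ^ 2 * c⁻¹ = 1 := by rw [← conj_pow, hc, hv2]
    refine ⟨fun h => hv1 ?_, conj_eq_one_iff.1 h2⟩
    rw [← hc, h]; simp
  have hw1 : w ≠ 1 := by rintro rfl; simp at hw2
  generalize {g : G | g ≠ 1 ∧ ∃ Q : Sylow 3 G, g ∈ Q} = S3 at *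
  generalize {g : G | g ≠ 1 ∧ ∃ Q : Sylow 7 G, g ∈ Q} = S7 at *
  generalize {g : G | IsConj g v} = Sv at *
  have d1 : Disjoint S3 S7 := Set.disjoint_left.2 fun g h h' =>
    (h3pow g h).1 (eq_one_of_pow_coprime (h3pow g h).2 (h7pow g h').2 (by norm_num))
  have d2 : Disjoint (S3 ∪ S7) Sv := Set.disjoint_left.2 fun g h h' => by
    rcases h with h | h
    · exact (h3pow g h).1 (eq_one_of_pow_coprime (h3pow g h).2 (h2pow g h').2 (by norm_num))
    · exact (h7pow g h).1 (eq_one_of_pow_coprime (h7pow g h).2 (h2pow g h').2 (by norm_num))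
  have n1 : w ∉ S3 ∪ S7 ∪ Sv := by
    rintro ((h | h) | h)
    · exact hw1 (eq_one_of_pow_coprime (h3pow w h).2 hw (by norm_num))
    · exact hw1 (eq_one_of_pow_coprime (h7pow w h).2 hw (by norm_num))
    · exact hw2 (h2pow w h).2
  have n2 : 1 ∉ insert w (S3 ∪ S7 ∪ Sv) := by
    rintro (h | (h | h) | h)
    · exact hw1 h.symm
    · exact (h3pow 1 h).1 rfl
    · exact (h7pow 1 h).1 rfl
    · exact (h2pow 1 h).1 rfl
  have htot : (insert 1 (insert w (S3 ∪ S7 ∪ Sv))).ncard ≤ 504 := by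
    rw [← hc, ← Set.ncard_univ]
    exact Set.ncard_le_ncard (Set.subset_univ _)
  rw [Set.ncard_insert_of_notMem n2, Set.ncard_insert_of_notMem n1, Set.ncard_union_eq d2,
    Set.ncard_union_eq d1] at htot
  omega

end Sylow

/-! ### Generating pairs, the even subgroup, quotients of the (2,3,4) group -/

/-- `x` and `y` generate `G` and satisfy the relations of the triangle group `(2, 3, 8)`. -/
structure IsTriangleGen {G : Type*} [Group G] (x y : G) : Prop where
  sq : x ^ 2 = 1
  cube : y ^ 3 = 1
  pow_eight : (x * y) ^ 8 = 1
  closure_eq : Subgroup.closure {x, y} = ⊤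

namespace IsTriangleGen

variable {G : Type*} [Group G] {x y : G}

theorem map {H : Type*} [Group H] (h : IsTriangleGen x y) {f : G →* H}
    (hf : Function.Surjective f) : IsTriangleGen (f x) (f y) where
  sq := by rw [← map_pow, h.sq, map_one]
  cube := by rw [← map_pow, h.cube, map_one]
  pow_eight := by rw [← map_mul, ← map_pow, h.pow_eight, map_one]
  closure_eq := by
    have := f.map_closure {x, y}
    rw [h.closure_eq, Subgroup.map_top_of_surjective f hf, Set.image_pair] at this
    exact this.symm

theorem inv_x (h : IsTriangleGen x y) : x⁻¹ = x := by
  rw [inv_eq_iff_mul_eq_one, ← pow_two, h.sq]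

theorem xx (h : IsTriangleGen x y) : x * x = 1 := by rw [← pow_two, h.sq]

theorem induction (h : IsTriangleGen x y) {p : G → Prop} (hx : p x) (hy : p y) (h1 : p 1)
    (hmul : ∀ a b, p a → p b → p (a * b)) (hinv : ∀ a, p a → p a⁻¹) (g : G) : p g := by
  have : g ∈ Subgroup.closure {x, y} := h.closure_eq ▸ Subgroup.mem_top g
  induction this using Subgroup.closure_induction with
  | mem a ha => rcases ha with rfl | rfl <;> assumption
  | one => exact h1
  | mul a b _ _ ha hb => exact hmul a b ha hb
  | inv a _ ha => exact hinv a ha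

theorem le_normalizer (h : IsTriangleGen x y) {N : Subgroup G}
    (hx : ∀ n ∈ N, x * n * x⁻¹ ∈ N) (hy : ∀ n ∈ N, y * n * y⁻¹ ∈ N) : N.Normal := by
  have key : ∀ g : G, ∀ n ∈ N, g * n * g⁻¹ ∈ N := by
    intro g
    have : g ∈ Submonoid.closure {x, y} := by
      have h2 : x⁻¹ ∈ Submonoid.closure {x, y} := by
        rw [h.inv_x]; exact Submonoid.subset_closure (by simp)
      have h3 : y⁻¹ ∈ Submonoid.closure {x, y} := by
        rw [inv_eq_of_mul_eq_one_right (show y * y ^ 2 = 1 by rw [← pow_succ', h.cube])]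
        exact pow_mem (Submonoid.subset_closure (by simp)) 2
      have h4 : g ∈ (Subgroup.closure {x, y}).toSubmonoid := by
        rw [h.closure_eq]; trivial
      rw [Subgroup.closure_toSubmonoid] at h4
      refine Submonoid.closure_le.2 ?_ h4
      rintro a (ha | ha)
      · exact Submonoid.subset_closure ha
      · rcases ha with ha | ha
        · rw [← inv_inv a, ha]; exact h2
        · rw [← inv_inv a, ha]; exact h3
    induction this using Submonoid.closure_induction with
    | mem a ha => rcases ha with rfl | rfl <;> assumption
    | one => simp
    | mul a b _ _ ha hb =>
      intro n hn
      have := ha _ (hb n hn)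
      rwa [mul_inv_rev, mul_assoc a b n, mul_assoc, ← mul_assoc _ b⁻¹, ← mul_assoc, ← mul_assoc] at *
  exact ⟨fun n hn g => key g n hn⟩

/-- In an abelian image the last relation reads y⁸ = 1, against y³ = 1. -/
theorem map_y_eq_one {A : Type*} [CommGroup A] (h : IsTriangleGen x y) (f : G →* A) : f y = 1 := by
  have h1 := congrArg f h.pow_eight
  have h2 := congrArg f h.cube
  have h3 := congrArg f h.sq
  simp only [map_pow, map_mul, map_one] at h1 h2 h3
  have h4 : f x ^ 8 = 1 := by rw [show 8 = 2 * 4 from rfl, pow_mul, h3, one_pow]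
  rw [mul_pow, h4, one_mul] at h1
  have h5 : f y ^ 9 = 1 := by rw [show 9 = 3 * 3 from rfl, pow_mul, h2, one_pow]
  rwa [pow_succ, h1, one_mul] at h5

theorem hom_ext {A : Type*} [Group A] (h : IsTriangleGen x y) {f f' : G →* A}
    (hx : f x = f' x) (hy : f y = f' y) : f = f' := by
  ext g
  refine h.induction (p := fun g => f g = f' g) hx hy (by simp) (fun a b ha hb => ?_) (fun a ha => ?_) g
  · rw [map_mul, map_mul, ha, hb]
  · rw [map_inv, map_inv, ha]

/-- The subgroup of words of even length in `x`. -/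
def even (x y : G) : Subgroup G := Subgroup.closure {y, x * y * x⁻¹}

theorem y_mem : y ∈ even x y := Subgroup.subset_closure (by simp)

theorem conj_mem : x * y * x⁻¹ ∈ even x y := Subgroup.subset_closure (by simp)

theorem even_normal (h : IsTriangleGen x y) : (even x y).Normal := by
  refine h.le_normalizer (fun n hn => ?_) (fun n hn => ?_)
  · induction hn using Subgroup.closure_induction with
    | mem a ha =>
      rcases ha with rfl | rfl
      · exact conj_mem
      · have : x * (x * y * x⁻¹) * x⁻¹ = y := by
          rw [h.inv_x, mul_assoc x y x, ← mul_assoc x x, h.xx, one_mul, mul_assoc, h.xx, mul_one]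
        rw [this]; exact y_mem
    | one => simp
    | mul a b _ _ ha hb => rw [← conj_mul]; exact mul_mem ha hb
    | inv a _ ha => rw [← conj_inv]; exact inv_mem ha
  · exact mul_mem (mul_mem y_mem hn) (inv_mem y_mem)

theorem even_index (h : IsTriangleGen x y) : (even x y).index = 1 ∨ (even x y).index = 2 := by
  have := h.even_normal
  have key : ∀ g : G, g ∈ even x y ∨ x * g ∈ even x y := by
    intro g
    refine h.induction (p := fun g => g ∈ even x y ∨ x * g ∈ even x y) ?_ ?_ ?_ ?_ ?_ g
    · right; rw [h.xx]; exact one_mem _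
    · left; exact y_mem
    · left; exact one_mem _
    · rintro a b (ha | ha) (hb | hb)
      · exact Or.inl (mul_mem ha hb)
      · right
        have := mul_mem (this.conj_mem a ha x) hb
        rwa [h.inv_x, mul_assoc, ← mul_assoc x x, h.xx, one_mul, mul_assoc] at this
      · right; rw [← mul_assoc]; exact mul_mem ha hb
      · left
        have := mul_mem (this.conj_mem _ ha x) hb
        rwa [h.inv_x, ← mul_assoc x x, h.xx, one_mul, mul_assoc, ← mul_assoc x x, h.xx,
          one_mul] at this
    · rintro a (ha | ha)
      · exact Or.inl (inv_mem ha)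
      · right
        have := this.conj_mem _ (inv_mem ha) x
        rwa [mul_inv_rev, h.inv_x, mul_assoc, mul_assoc, h.xx, mul_one] at this
  by_cases hx : x ∈ even x y
  · left
    rw [Subgroup.index_eq_one, eq_top_iff]
    intro g _
    rcases key g with hg | hg
    · exact hg
    · have := mul_mem hx hg
      rwa [← mul_assoc, h.xx, one_mul] at this
  · right
    rw [Subgroup.index_eq_two_iff']
    refine ⟨x, fun g => ?_⟩
    rw [xor_iff_or_and_not_and]
    refine ⟨(key g).symm, fun ⟨h1, h2⟩ => hx ?_⟩
    have := mul_mem h1 (inv_mem h2)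
    rwa [mul_inv_cancel_right] at this

/-- The even subgroup is generated by elements of order dividing `3`. -/
theorem even_hom_eq_one {A : Type*} [Group A] (h : IsTriangleGen x y) (f : even x y →* A)
    (hf : ∀ g, g ^ 3 = 1 → f g = 1) (g : even x y) : f g = 1 := by
  obtain ⟨g, hg⟩ := g
  induction hg using Subgroup.closure_induction with
  | mem a ha =>
    refine hf _ (Subtype.ext ?_)
    simp only [Subgroup.coe_pow, Subgroup.coe_one]
    rcases ha with rfl | rfl
    · exact h.cube
    · rw [conj_pow, h.cube]; simp
  | one => exact map_one f
  | mul a b ha hb iha ihb =>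
    have := map_mul f ⟨a, ha⟩ ⟨b, hb⟩
    rw [iha, ihb, one_mul] at this
    exact this
  | inv a ha iha =>
    have := map_inv f ⟨a, ha⟩
    rw [iha, inv_one] at this
    exact this

/-- Now `x` inverts `y`, so the even subgroup is contained in the powers of `y`. -/
theorem card_dvd_six [Finite G] (h : IsTriangleGen x y) (h2 : (x * y) ^ 2 = 1) :
    Nat.card G ∣ 6 := by
  have h1 : x * y * x⁻¹ = y⁻¹ := by
    rw [h.inv_x]
    apply eq_inv_of_mul_eq_one_left
    rw [← h2, pow_two, mul_assoc (x * y)]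
  have h3 : even x y ≤ Subgroup.zpowers y := by
    rw [even, Subgroup.closure_le]
    rintro a (rfl | rfl)
    · exact Subgroup.mem_zpowers _
    · rw [h1]; exact inv_mem (Subgroup.mem_zpowers _)
  have h4 : Nat.card (even x y) ∣ 3 :=
    (Subgroup.card_dvd_of_le h3).trans
      (by rw [Nat.card_zpowers]; exact orderOf_dvd_of_pow_eq_one h.cube)
  have h5 : (even x y).index ∣ 2 := by
    rcases h.even_index with h | h <;> rw [h]
    exact one_dvd 2
  rw [← Subgroup.card_mul_index (even x y)]
  exact mul_dvd_mul h4 h5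

theorem exists_subgroup_klein {a b c : G} (haa : a * a = 1) (hbb : b * b = 1) (hcc : c * c = 1)
    (hab : a * b = c) (hba : b * a = c) (hac : a * c = b) (hca : c * a = b) (hbc : b * c = a)
    (hcb : c * b = a) : ∃ V : Subgroup G, ∀ g, g ∈ V ↔ g = 1 ∨ g = a ∨ g = b ∨ g = c := by
  have hai : a⁻¹ = a := (eq_inv_of_mul_eq_one_left haa).symm
  have hbi : b⁻¹ = b := (eq_inv_of_mul_eq_one_left hbb).symm
  have hci : c⁻¹ = c := (eq_inv_of_mul_eq_one_left hcc).symm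
  refine ⟨{ carrier := {1, a, b, c}
            one_mem' := by simp
            mul_mem' := ?_
            inv_mem' := ?_ }, fun g => Iff.rfl⟩
  · rintro g g' (rfl | rfl | rfl | rfl) (rfl | rfl | rfl | rfl) <;>
      simp only [*, Set.mem_insert_iff, Set.mem_singleton_iff, one_mul, mul_one, true_or, or_true]
  · rintro g (rfl | rfl | rfl | rfl) <;> simp [*]

/-- A quotient of the triangle group `(2, 3, 4)` is a `2`-group by a group of order dividing `6`. -/
theorem card_dvd_of_pow_four [Finite G] (h : IsTriangleGen x y) (h4 : (x * y) ^ 4 = 1) :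
    ∃ n, Nat.card G ∣ 2 ^ n * 6 := by
  have hx := h.xx
  have hyy : y * y = y⁻¹ := by
    apply eq_inv_of_mul_eq_one_left
    rw [← h.cube, pow_succ, pow_two]
  -- With the identity, (xy)² and its two conjugates by powers of `y` form the image of the Klein
  -- four-group of S₄. It is normal, and modulo it `card_dvd_six` applies.
  obtain ⟨a, ha⟩ : ∃ a, a = x * y * (x * y) := ⟨_, rfl⟩
  obtain ⟨b, hb⟩ : ∃ b, b = y * a * y⁻¹ := ⟨_, rfl⟩
  obtain ⟨c, hc⟩ : ∃ c, c = y * b * y⁻¹ := ⟨_, rfl⟩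
  have hca : y * c * y⁻¹ = a := by
    have : y * c * y⁻¹ = y * y * y * a * (y * y * y)⁻¹ := by rw [hc, hb]; group
    rw [this, hyy, inv_mul_cancel]; group
  have haa : a * a = 1 := by
    rw [ha, ← h4]; simp only [pow_succ, pow_zero, one_mul, mul_assoc]
  have hbb : b * b = 1 := by rw [hb, conj_mul, haa]; simp
  have hcc : c * c = 1 := by rw [hc, conj_mul, hbb]; simp
  have hb' : b = y * x * (y * x) := by rw [hb, ha]; group
  have hc' : c = y⁻¹ * (x * (y * (x * y⁻¹))) := by
    have : c = y * y * a * (y * y)⁻¹ := by rw [hc, hb]; group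
    rw [this, hyy, ha, inv_inv]
    calc _ = y⁻¹ * (x * (y * (x * (y * y)))) := by group
      _ = _ := by rw [hyy]
  have ha2 : a = y⁻¹ * (x * (y⁻¹ * x)) := by
    rw [eq_inv_of_mul_eq_one_left haa, ha]
    simp only [mul_inv_rev, h.inv_x, mul_assoc]
  have hb2 : b = x * (y⁻¹ * (x * y⁻¹)) := by
    rw [eq_inv_of_mul_eq_one_left hbb, hb']
    simp only [mul_inv_rev, h.inv_x, mul_assoc]
  have hab : a * b = c := by
    rw [ha2, hb2, hc']
    calc _ = y⁻¹ * (x * (y⁻¹ * ((x * x) * (y⁻¹ * (x * y⁻¹))))) := by group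
      _ = y⁻¹ * (x * ((y * y)⁻¹ * (x * y⁻¹))) := by rw [hx]; group
      _ = _ := by rw [hyy, inv_inv]
  have hbc : b * c = a := by
    have := congrArg (fun g => y * g * y⁻¹) hab
    simp only [← conj_mul] at this
    rwa [← hb, ← hc, hca] at this
  have hcab : c * a = b := by
    have := congrArg (fun g => y * g * y⁻¹) hbc
    simp only [← conj_mul] at this
    rwa [← hc, hca, ← hb] at this
  have hba : b * a = c := by rw [← hcab, mul_assoc, haa, mul_one]
  have hcb : c * b = a := by rw [← hab, mul_assoc, hbb, mul_one]
  have hac : a * c = b := by rw [← hbc, mul_assoc, hcc, mul_one]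
  have hxa : x * a * x = b := by
    rw [ha, hb']
    calc _ = (x * x) * (y * x * (y * x)) := by group
      _ = _ := by rw [hx, one_mul]
  have hxb : x * b * x = a := by
    rw [← hxa]
    calc _ = (x * x) * a * (x * x) := by group
      _ = a := by rw [hx]; group
  have hxc : x * c * x = c := by
    calc x * c * x = x * a * (x * x) * b * x := by rw [hx, ← hab]; group
      _ = (x * a * x) * (x * b * x) := by group
      _ = c := by rw [hxa, hxb, hba]
  obtain ⟨V, hV⟩ := exists_subgroup_klein haa hbb hcc hab hba hac hcab hbc hcb
  have hn : V.Normal := by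
    refine h.le_normalizer (fun n hn => ?_) (fun n hn => ?_)
    · rw [h.inv_x]
      rcases (hV n).1 hn with rfl | rfl | rfl | rfl <;> rw [hV] <;> simp [hxa, hxb, hxc, hx]
    · rcases (hV n).1 hn with rfl | rfl | rfl | rfl <;> rw [hV]
      · simp
      · simp [← hb]
      · simp [← hc]
      · simp [hca]
  have hp : IsPGroup 2 V := by
    rintro ⟨g, hg⟩
    refine ⟨1, Subtype.ext ?_⟩
    simp only [pow_one, Subgroup.coe_one, pow_two]
    rcases (hV g).1 hg with rfl | rfl | rfl | rfl
    · simp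
    · exact haa
    · exact hbb
    · exact hcc
  obtain ⟨n, hn'⟩ := hp.exists_card_eq
  have h6 := (h.map (QuotientGroup.mk'_surjective V)).card_dvd_six (by
    rw [← map_mul, ← map_pow, ← MonoidHom.mem_ker, QuotientGroup.ker_mk', hV]
    right; left; rw [ha, pow_two])
  refine ⟨n, ?_⟩
  rw [Subgroup.card_eq_card_quotient_mul_card_subgroup V, hn', mul_comm]
  exact mul_dvd_mul_left _ h6

end IsTriangleGen

/-! ### Order 1152: the action on 9 points -/

theorem pow_smul_injOn {G X : Type*} [Group G] [MulAction G X] {z : G} {a : X} (h8 : z ^ 8 = 1)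
    (h4 : z ^ 4 • a ≠ a) {i j : ℕ} (hi : i < 8) (hj : j < 8) (h : z ^ i • a = z ^ j • a) :
    i = j := by
  have hp : period z a ∣ 2 ^ 3 := by
    rw [← pow_smul_eq_iff_period_dvd]; norm_num [h8]
  have hp4 : ¬ period z a ∣ 4 := by
    rwa [← pow_smul_eq_iff_period_dvd]
  obtain ⟨m, hm, hm'⟩ := (Nat.dvd_prime_pow Nat.prime_two).1 hp
  have h3 : m = 3 := by
    interval_cases m <;> simp_all
  wlog hij : i ≤ j generalizing i j
  · exact (this hj hi h.symm (by omega)).symm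
  have : z ^ (j - i) • a = a := by
    have h5 : z ^ j • a = z ^ i • z ^ (j - i) • a := by
      rw [← mul_smul, ← pow_add, Nat.add_sub_cancel' hij]
    rw [h5] at h
    exact (smul_left_cancel _ h).symm
  rw [pow_smul_eq_iff_period_dvd, hm', h3] at this
  have := Nat.eq_zero_of_dvd_of_lt this (by omega)
  omega

/-- The permutation of `Fin 9` with an 8-cycle and the fixed point `8`. -/
def rot9 (i : Fin 9) : Fin 9 := ![1, 2, 3, 4, 5, 6, 7, 0, 8] i

/-- Constraints are interleaved with the quantifiers so that `decide` prunes the search early. -/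
theorem rot9_solutions_aux : ∀ v2 v6 : Fin 9, v6 = rot9 v2 → ∀ v3 : Fin 9, v3 ≠ v2 → v3 ≠ v6 → ∀ v4 : Fin 9,
    v4 ≠ v2 → v4 ≠ v3 → v4 ≠ v6 → ∀ v5 : Fin 9,
    (∀ i, ![8, 7, v2, v3, v4, v5, v6, 1, 0] (![8, 7, v2, v3, v4, v5, v6, 1, 0] i) = i) →
    (∀ i, (fun i => ![8, 7, v2, v3, v4, v5, v6, 1, 0] (rot9 i))^[3] i = i) →
    (∀ i, ![8, 7, v2, v3, v4, v5, v6, 1, 0] (rot9 i) ≠ i) →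
    (![8, 7, v2, v3, v4, v5, v6, 1, 0] = (![8, 7, 2, 6, 4, 5, 3, 1, 0] : Fin 9 → Fin 9)) ∨
    (![8, 7, v2, v3, v4, v5, v6, 1, 0] = (![8, 7, 5, 3, 4, 2, 6, 1, 0] : Fin 9 → Fin 9)) := by
  decide

/-- Here `f` is x and `rot9` is z, so `f ∘ rot9` is y. The condition `f 8 = 0` only normalises the
labelling. -/
theorem rot9_solutions (f : Fin 9 → Fin 9) (hf : ∀ i, f (f i) = i) (h8 : f 8 = 0)
    (h3 : ∀ i, f (rot9 (f (rot9 (f (rot9 i))))) = i) (hne : ∀ i, f (rot9 i) ≠ i) :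
    f = ![8, 7, 2, 6, 4, 5, 3, 1, 0] ∨ f = ![8, 7, 5, 3, 4, 2, 6, 1, 0] := by
  have h0 : f 0 = 8 := by rw [← h8, hf]
  have h1 : f 1 = 7 := by
    have := h3 7
    rwa [show rot9 7 = 0 from rfl, h0, show rot9 8 = 8 from rfl, h8, show rot9 0 = 1 from rfl] at this
  have h7 : f 7 = 1 := by rw [← h1, hf]
  have h6 : f 6 = rot9 (f 2) := by
    have := h3 6
    rw [show rot9 6 = 7 from rfl, h7, show rot9 1 = 2 from rfl] at this
    rw [← this, hf]
  have key : f = ![8, 7, f 2, f 3, f 4, f 5, f 6, 1, 0] := by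
    ext i
    fin_cases i <;> simp [*]
  rw [key]
  have hinj : ∀ i j, i ≠ j → f i ≠ f j := fun i j hij h => hij (by rw [← hf i, h, hf])
  refine rot9_solutions_aux _ _ h6 _ (hinj _ _ (by decide)) (hinj _ _ (by decide)) _
    (hinj _ _ (by decide)) (hinj _ _ (by decide)) (hinj _ _ (by decide)) _ ?_ ?_ ?_ <;> rw [← key]
  · exact hf
  · exact h3
  · exact hne

theorem IsTriangleGen.card_ne_1152 {G : Type*} [Group G] [Finite G] {x y : G}
    (h : IsTriangleGen x y) : Nat.card G ≠ 1152 := by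
  intro hG
  obtain ⟨S⟩ : Nonempty (Sylow 2 G) := inferInstance
  have hS : Nat.card (S : Subgroup G) = 128 :=
    S.card_eq_of_card_eq (n := 7) (m := 9) (by rw [hG]; norm_num) (by norm_num)
  let X := G ⧸ (S : Subgroup G)
  have hX : Nat.card X = 9 := by
    have := Subgroup.card_eq_card_quotient_mul_card_subgroup (S : Subgroup G)
    change _ = Nat.card X * _ at this
    rw [hG, hS] at this
    omega
  have hstab : ∀ (g : G) (a : X), g • a = a → g ^ 128 = 1 := by
    intro g a hga
    have h1 := index_stabilizer_of_transitive G a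
    have h2 := Subgroup.card_mul_index (stabilizer G a)
    rw [h1, hX, hG] at h2
    have h3 : Nat.card (stabilizer G a) = 128 := by omega
    have h4 := pow_card_eq_one' (x := (⟨g, hga⟩ : stabilizer G a))
    rw [h3] at h4
    exact congrArg Subtype.val h4
  have hyfix : ∀ a : X, y • a ≠ a := by
    intro a ha
    have h1 := hstab y a ha
    have h2 : y = 1 := by
      -- 129 = 3 · 43 is a multiple of 3 congruent to 1 modulo 128; the end of the proof uses it
      -- again.
      have : y ^ 129 = 1 := by
        rw [show 129 = 3 * 43 from rfl, pow_mul, h.cube, one_pow]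
      rwa [pow_succ, h1, one_mul] at this
    have h3 := h.card_dvd_six (by rw [h2, mul_one, h.sq])
    rw [hG] at h3
    omega
  set z := x * y with hz
  have hz8 : z ^ 8 = 1 := h.pow_eight
  have hyz : ∀ a : X, y • a = x • z • a := by
    intro a
    rw [← mul_smul, hz, ← mul_assoc, h.xx, one_mul]
  have hxx : ∀ a : X, x • x • a = a := by
    intro a
    rw [← mul_smul, h.xx, one_smul]
  obtain ⟨p, hp⟩ : ∃ p : X, z ^ 4 • p ≠ p := by
    by_contra! hcon
    have hr := h.map (toPermHom G X).rangeRestrict_surjective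
    obtain ⟨n, hn⟩ := hr.card_dvd_of_pow_four (by
      rw [← map_mul, ← map_pow]
      apply Subtype.ext
      ext a
      exact hcon a)
    have h9 : 9 ∣ Nat.card (toPermHom G X).range := by
      have h1 : IsPretransitive (toPermHom G X).range X := by
        refine ⟨fun a b => ?_⟩
        obtain ⟨g, hg⟩ := exists_smul_eq G a b
        exact ⟨⟨toPermHom G X g, g, rfl⟩, hg⟩
      have p0 : X := ((1 : G) : G ⧸ (S : Subgroup G))
      rw [← hX, ← index_stabilizer_of_transitive (toPermHom G X).range p0]
      exact Subgroup.index_dvd_card _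
    have h10 := h9.trans hn
    have : 9 ∣ 6 := (Nat.Coprime.pow_right n (by norm_num : Nat.Coprime 9 2)).dvd_of_dvd_mul_left h10
    omega
  obtain ⟨q, hq⟩ : ∃ q : X, z • q = q := by
    have h2 : IsPGroup 2 (Subgroup.zpowers z) := by
      apply IsPGroup.of_card_dvd_pow (n := 3)
      rw [Nat.card_zpowers]
      exact orderOf_dvd_of_pow_eq_one h.pow_eight
    obtain ⟨q, hq⟩ := h2.nonempty_fixed_point_of_prime_not_dvd_card X (by rw [hX]; norm_num)
    exact ⟨q, hq ⟨z, Subgroup.mem_zpowers z⟩⟩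
  have hzq : ∀ n : ℕ, z ^ n • q = q := fun n =>
    mem_stabilizer_iff.1 (pow_mem (mem_stabilizer_iff.2 hq) n)
  have label : ∀ a : X, z ^ 4 • a ≠ a → ∃ E : Fin 9 ≃ X, E 8 = q ∧ E 0 = a ∧
      (∀ i, z • E i = E (rot9 i)) ∧ ∀ i, i ≠ 8 → ∃ n : ℕ, E i = z ^ n • a := by
    intro a ha
    let e : Fin 9 → X := fun i => if i = 8 then q else z ^ (i : ℕ) • a
    have hne : ∀ n : ℕ, z ^ n • a ≠ q := by
      intro n hn
      apply ha
      have : a = q := by rw [← hzq n] at hn; exact smul_left_cancel _ hn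
      rw [this, hzq]
    have hinj : Function.Injective e := by
      intro i j hij
      simp only [e] at hij
      split_ifs at hij with h1 h2 h2
      · rw [h1, h2]
      · exact absurd hij.symm (hne _)
      · exact absurd hij (hne _)
      · exact Fin.ext (pow_smul_injOn h.pow_eight ha (by omega) (by omega) hij)
    have hbij := hinj.bijective_of_nat_card_le (by rw [hX]; simp)
    refine ⟨Equiv.ofBijective e hbij, by simp [e], by simp [e], ?_, ?_⟩
    · intro i
      simp only [Equiv.ofBijective_apply]
      fin_cases i <;> simp [e, rot9, hq, ← mul_smul, ← pow_succ', ← pow_two, hz8]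
    · intro i hi
      exact ⟨i, by simp [e, hi]⟩
  -- Since y fixes nothing, x moves `q`, so `x • q` lies on the 8-cycle and can be its starting
  -- label.
  have ha : z ^ 4 • x • q ≠ x • q := by
    obtain ⟨E, h1, -, -, h4⟩ := label p hp
    have hne : x • q ≠ q := fun hh => hyfix q (by rw [hyz, hq, hh])
    obtain ⟨n, hn⟩ := h4 (E.symm (x • q)) (by
      intro hh
      rw [Equiv.symm_apply_eq, h1] at hh
      exact hne hh)
    rw [Equiv.apply_symm_apply] at hn
    rw [hn, ← mul_smul, ← pow_add, add_comm, pow_add, mul_smul]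
    exact fun hh => hp (smul_left_cancel _ hh)
  obtain ⟨E, hE8, hE0, hEz, -⟩ := label _ ha
  obtain ⟨f, hfx⟩ : ∃ f : Fin 9 → Fin 9, ∀ i, x • E i = E (f i) :=
    ⟨fun i => E.symm (x • E i), fun i => by simp⟩
  have hfy : ∀ i, y • E i = E (f (rot9 i)) := fun i => by rw [hyz, hEz, hfx]
  have hf := rot9_solutions f (fun i => E.injective (by rw [← hfx, ← hfx, hxx]))
    (E.injective (by rw [← hfx, hE8, hE0]))
    (fun i => E.injective (by
      rw [← hfy, ← hfy, ← hfy, ← mul_smul, ← mul_smul, ← pow_two, ← pow_succ, h.cube, one_smul]))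
    (fun i hi => hyfix (E i) (by rw [hfy, hi]))
  have hu : ∀ i, (x * z ^ 3) ^ 2 • E i =
      E (f (rot9 (rot9 (rot9 (f (rot9 (rot9 (rot9 i)))))))) := by
    intro i
    simp only [pow_succ, pow_zero, one_mul, mul_smul, hEz, hfx]
  -- In both solutions this word fixes label 4 but moves label 0 in a 3-cycle.
  set u := (x * z ^ 3) ^ 2
  have hu4 : u • E 4 = E 4 := by
    rw [hu]; rcases hf with rfl | rfl <;> rfl
  have hu0 : u • E 0 ≠ E 0 := by
    rw [hu, Ne, E.injective.eq_iff]; rcases hf with rfl | rfl <;> decide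
  have hu3 : u ^ 3 • E 0 = E 0 := by
    rw [pow_succ, pow_two, mul_smul, mul_smul, hu, hu, hu]; rcases hf with rfl | rfl <;> rfl
  have h128 := hstab u _ hu4
  apply hu0
  have : u ^ 129 • E 0 = E 0 := by
    rw [show 129 = 3 * 43 from rfl, pow_mul]
    exact mem_stabilizer_iff.1 (pow_mem (mem_stabilizer_iff.2 hu3) 43)
  rwa [pow_succ, h128, one_mul] at this

/-! ### Order 2016: descent along central involutions -/

namespace Sylow

/-- In a perfect group of order `504 * 2 ^ k` with `36` Sylow `7`-subgroups, squares of elements of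
order `4` are central. -/
theorem sq_mem_center (k : ℕ) : ∀ {G : Type*} [Group G] [Finite G], commutator G = ⊤ →
    Nat.card G = 504 * 2 ^ k → Nat.card (Sylow 7 G) = 36 → ∀ {w : G}, w ^ 4 = 1 →
    w ^ 2 ∈ Subgroup.center G := by
  induction k with
  | zero =>
    intro G _ _ hG hc h36 w hw
    rw [sq_eq_one_of_card_eq_504 hG (by simpa using hc) h36 hw]
    exact one_mem _
  | succ k ih =>
    intro G _ _ hG hc h36 w hw
    have f7 : Fact (Nat.Prime 7) := ⟨by norm_num⟩
    have hpow : ∀ m : ℕ, (2 ^ m).Coprime 7 := fun m => Nat.Coprime.pow_left m (by norm_num)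
    have hcard : ∀ P : Sylow 7 G, Nat.card (P : Subgroup G) = 7 := fun P => by
      simpa using P.card_eq_of_card_eq (n := 1) (m := 72 * 2 ^ (k + 1)) (by rw [hc]; ring)
        ((Nat.Prime.coprime_iff_not_dvd (by norm_num)).1
          (Nat.Coprime.mul_right (by norm_num) (hpow _).symm))
    have hcardN : ∀ P : Sylow 7 G,
        Nat.card (Subgroup.normalizer (P : Set G)) = 14 * 2 ^ (k + 1) := fun P => by
      have h9 := Subgroup.card_mul_index (Subgroup.normalizer (P : Set G))
      rw [← card_eq_index_normalizer, h36, hc] at h9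
      omega
    have h3 : ∀ P : Sylow 7 G, ¬ 3 ∣ Nat.card (Subgroup.normalizer (P : Set G)) := fun P => by
      rw [hcardN, ← Nat.Prime.coprime_iff_not_dvd (by norm_num)]
      exact Nat.Coprime.mul_right (by norm_num) (Nat.Coprime.pow_right _ (by norm_num))
    obtain ⟨P⟩ : Nonempty (Sylow 7 G) := inferInstance
    -- Factoring out this involution, which turns out to be central in `G`, halves the order and
    -- keeps the 36 Sylow subgroups.
    obtain ⟨t, ht1, ht2, htN⟩ := exists_involution_commute_normalizer (hcard P) (hcardN P)
    have htc := mem_center_of_commute_normalizer hG hcard h36 h3 ht2 htN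
    have hle : Subgroup.zpowers t ≤ Subgroup.center G := Subgroup.zpowers_le.2 htc
    have hn : (Subgroup.zpowers t).Normal := ⟨fun a ha g => by
      rwa [Subgroup.mem_center_iff.1 (hle ha) g, mul_inv_cancel_right]⟩
    have h2 : Nat.card (Subgroup.zpowers t) = 2 := by
      rw [Nat.card_zpowers]; exact orderOf_eq_prime ht2 ht1
    have hq := Subgroup.card_eq_card_quotient_mul_card_subgroup (Subgroup.zpowers t)
    rw [h2, hc] at hq
    have h4 := ih (commutator_quotient_eq_top hG (Subgroup.zpowers t)) (by rw [pow_succ] at hq; omega)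
      ((card_quotient_of_central hle (by rw [h2]; norm_num) hcard).trans h36)
      (w := (w : G ⧸ Subgroup.zpowers t)) (by
        rw [← QuotientGroup.mk_pow, hw]; rfl)
    refine mem_center_of_quotient hG hle (fun g => ?_)
    rw [← QuotientGroup.eq_one_iff]
    have h5 := Subgroup.mem_center_iff.1 h4 (g : G ⧸ Subgroup.zpowers t)
    simp only [QuotientGroup.mk_mul, QuotientGroup.mk_inv, QuotientGroup.mk_pow]
    rw [← h5]; group

theorem le_of_not_dvd_index {G : Type*} [Group G] [Finite G] {p : ℕ} [hp : Fact p.Prime]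
    {H : Subgroup G} [H.Normal] (hH : ¬ p ∣ H.index) (P : Sylow p G) : (P : Subgroup G) ≤ H := by
  intro a ha
  obtain ⟨n, hn⟩ := P.2 ⟨a, ha⟩
  have hn' : a ^ p ^ n = 1 := congrArg Subtype.val hn
  rw [← QuotientGroup.eq_one_iff]
  refine eq_one_of_pow_coprime (m := H.index) (n := p ^ n) ?_ ?_
    (Nat.Coprime.pow_right n ((Nat.Prime.coprime_iff_not_dvd hp.out).2 hH).symm)
  · exact pow_card_eq_one'
  · rw [← QuotientGroup.mk_pow, hn']; rfl

theorem card_eq_of_not_dvd_index {G : Type*} [Group G] [Finite G] {p : ℕ} [hp : Fact p.Prime]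
    {H : Subgroup G} [H.Normal] (hH : ¬ p ∣ H.index) :
    Nat.card (Sylow p H) = Nat.card (Sylow p G) := by
  symm
  refine Nat.card_eq_of_bijective (fun P : Sylow p G => P.subtype (le_of_not_dvd_index hH P))
    ⟨fun P P' h => subtype_injective h, fun A => ?_⟩
  obtain ⟨P, hP⟩ := A.exists_comap_subtype_eq
  exact ⟨P, Sylow.ext hP⟩

end Sylow

/-! ### Order 2016: 1, 36 or 288 Sylow 7-subgroups -/

namespace IsTriangleGen

variable {G : Type*} [Group G] {x y : G}

theorem seven_not_dvd_index_even (h : IsTriangleGen x y) : ¬ 7 ∣ (even x y).index := by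
  rcases h.even_index with h | h <;> rw [h] <;> norm_num

variable [Finite G]

/-- A Sylow subgroup would be its own normaliser, so transfer would give a nontrivial map to a
7-group, in which x and y both die. -/
theorem card_sylow_ne_288 (h : IsTriangleGen x y) (hc : Nat.card G = 2016) :
    Nat.card (Sylow 7 G) ≠ 288 := by
  intro h288
  have f7 : Fact (Nat.Prime 7) := ⟨by norm_num⟩
  obtain ⟨P⟩ : Nonempty (Sylow 7 G) := inferInstance
  have hP : Nat.card (P : Subgroup G) = 7 := by
    simpa using P.card_eq_of_card_eq (n := 1) (m := 288) (by rw [hc]; norm_num) (by norm_num)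
  have hN : Subgroup.normalizer (P : Set G) = (P : Subgroup G) := by
    have h9 := Subgroup.card_mul_index (Subgroup.normalizer (P : Set G))
    rw [← Sylow.card_eq_index_normalizer, h288, hc] at h9
    exact (Subgroup.eq_of_le_of_card_ge Subgroup.le_normalizer (by
      change Nat.card (Subgroup.normalizer (P : Set G)) ≤ _
      omega)).symm
  have : Nontrivial (P : Subgroup G) := by
    rw [← Finite.one_lt_card_iff_nontrivial, hP]; norm_num
  obtain ⟨e, hne⟩ := exists_ne (1 : (P : Subgroup G))
  have hcomm := Sylow.commute_of_card_prime hP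
  refine hne (Subtype.ext (P.eq_one_of_commute_normalizer hcomm (fun χ g => ?_) e.2 fun n hn => ?_))
  · have h7 : ∀ a : (P : Subgroup G), a ^ 7 = 1 := fun a =>
      Subtype.ext (Subgroup.pow_eq_one_of_card_eq hP a.2)
    have : χ = 1 := h.hom_ext
      (eq_one_of_pow_coprime (m := 2) (by rw [← map_pow, h.sq, map_one]) (h7 _) (by norm_num))
      (eq_one_of_pow_coprime (m := 3) (by rw [← map_pow, h.cube, map_one]) (h7 _) (by norm_num))
    rw [this]; rfl
  · rw [hN] at hn
    exact hcomm n hn e e.2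

/-- The automorphism group of the normal `P` is abelian, so y acts trivially and the even subgroup
centralises `P`. Transfer there contradicts its generation by elements of order dividing 3. -/
theorem card_sylow_ne_one (h : IsTriangleGen x y) (hc : Nat.card G = 2016) :
    Nat.card (Sylow 7 G) ≠ 1 := by
  intro h1
  have f7 : Fact (Nat.Prime 7) := ⟨by norm_num⟩
  have := (Nat.card_eq_one_iff_unique.1 h1).1
  obtain ⟨P⟩ : Nonempty (Sylow 7 G) := inferInstance
  have hP : Nat.card (P : Subgroup G) = 7 := by
    simpa using P.card_eq_of_card_eq (n := 1) (m := 288) (by rw [hc]; norm_num) (by norm_num)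
  have hn : (P : Subgroup G).Normal := P.normal_of_subsingleton
  have hcyc := isCyclic_of_prime_card hP
  let ψ : G →* (ZMod (Nat.card (P : Subgroup G)))ˣ :=
    (IsCyclic.mulAutMulEquiv (P : Subgroup G)).toMonoidHom.comp MulAut.conjNormal
  have hψ : ∀ g, ψ g = 1 → ∀ a ∈ P, g * a = a * g := by
    intro g hg a ha
    have h2 : MulAut.conjNormal (H := (P : Subgroup G)) g = 1 :=
      (IsCyclic.mulAutMulEquiv (P : Subgroup G)).injective (by rw [map_one]; exact hg)
    have h3 := congrArg Subtype.val (DFunLike.congr_fun h2 ⟨a, ha⟩)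
    rw [MulAut.conjNormal_apply] at h3
    exact mul_inv_eq_iff_eq_mul.1 h3
  have hy := h.map_y_eq_one ψ
  have hL : even x y ≤ ψ.ker := by
    rw [even, Subgroup.closure_le]
    rintro a (rfl | rfl)
    · exact hy
    · exact ψ.normal_ker.conj_mem _ hy x
  have hLn := h.even_normal
  have hPL := P.le_of_not_dvd_index h.seven_not_dvd_index_even
  let A := P.subtype hPL
  have hA : Nat.card (A : Subgroup (even x y)) = 7 :=
    (Nat.card_congr (Subgroup.subgroupOfEquivOfLe hPL).toEquiv).trans hP
  have : Nontrivial (A : Subgroup (even x y)) := by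
    rw [← Finite.one_lt_card_iff_nontrivial, hA]; norm_num
  obtain ⟨e, hne⟩ := exists_ne (1 : (A : Subgroup (even x y)))
  refine hne (Subtype.ext (A.eq_one_of_commute_normalizer (Sylow.commute_of_card_prime hA)
    (fun χ => ?_) e.2 fun n _ => ?_))
  · refine h.even_hom_eq_one χ (fun g hg => ?_)
    refine eq_one_of_pow_coprime (m := 3) (n := 7) (by rw [← map_pow, hg, map_one])
      (Subtype.ext (Subgroup.pow_eq_one_of_card_eq hA (χ g).2)) (by norm_num)
  · exact Subtype.ext (hψ _ (hL n.2) _ e.2)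

/-- The abelianisation has exponent dividing 3, so the commutator subgroup contains `P` and its
normaliser, whose order is prime to 3. The Frattini argument finishes. -/
theorem commutator_even_eq_top (h : IsTriangleGen x y) {P : Sylow 7 (even x y)}
    (hP : Nat.card (P : Subgroup (even x y)) = 7)
    (h3 : ¬ 3 ∣ Nat.card (Subgroup.normalizer (P : Set (even x y)))) :
    commutator (even x y) = ⊤ := by
  have f7 : Fact (Nat.Prime 7) := ⟨by norm_num⟩
  have hcube : ∀ g : even x y, (Abelianization.of g) ^ 3 = 1 :=
    h.even_hom_eq_one ((powMonoidHom 3).comp Abelianization.of) (fun g hg => by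
      change (Abelianization.of g) ^ 3 = 1
      rw [← map_pow, hg, map_one])
  have hcop : ∀ (g : even x y) (m : ℕ), g ^ m = 1 → m.Coprime 3 → g ∈ commutator (even x y) := by
    intro g m hg hm
    rw [← Abelianization.ker_of, MonoidHom.mem_ker]
    exact eq_one_of_pow_coprime (m := m) (by rw [← map_pow, hg, map_one]) (hcube g) hm
  have hPK : (P : Subgroup (even x y)) ≤ commutator (even x y) := fun a ha =>
    hcop a 7 (Subgroup.pow_eq_one_of_card_eq hP ha) (by norm_num)
  have h1 := P.normalizer_sup_eq_top' hPK
  rw [sup_eq_right.2] at h1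
  · exact h1
  · intro n hn
    exact hcop n _ (Subgroup.pow_eq_one_of_card_eq rfl hn)
      ((Nat.Prime.coprime_iff_not_dvd (by norm_num)).2 h3).symm

/-- The even subgroup contains z², so `Sylow.sq_mem_center` puts z⁴ in its centre. The quotient of
`G` by that centre has order prime to 7, so the centre has an element of order 7, which transfer
forbids. -/
theorem card_sylow_ne_36 (h : IsTriangleGen x y) (hc : Nat.card G = 2016) :
    Nat.card (Sylow 7 G) ≠ 36 := by
  intro h36
  have f7 : Fact (Nat.Prime 7) := ⟨by norm_num⟩
  have hLn := h.even_normal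
  obtain ⟨k, hk⟩ : ∃ k, Nat.card (even x y) = 504 * 2 ^ k := by
    have h1 := Subgroup.card_mul_index (even x y)
    rcases h.even_index with h2 | h2 <;> rw [h2, hc] at h1
    · exact ⟨2, by omega⟩
    · exact ⟨1, by omega⟩
  have hL36 : Nat.card (Sylow 7 (even x y)) = 36 :=
    (Sylow.card_eq_of_not_dvd_index h.seven_not_dvd_index_even).trans h36
  have hcard : ∀ P : Sylow 7 (even x y), Nat.card (P : Subgroup (even x y)) = 7 := fun P => by
    simpa using P.card_eq_of_card_eq (n := 1) (m := 72 * 2 ^ k) (by rw [hk]; ring)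
      ((Nat.Prime.coprime_iff_not_dvd (by norm_num)).1
        (Nat.Coprime.mul_right (by norm_num) (Nat.Coprime.pow_right _ (by norm_num))))
  have hperf : commutator (even x y) = ⊤ := by
    obtain ⟨P⟩ : Nonempty (Sylow 7 (even x y)) := inferInstance
    refine h.commutator_even_eq_top (hcard P) ?_
    have h9 := Subgroup.card_mul_index (Subgroup.normalizer (P : Set (even x y)))
    rw [← Sylow.card_eq_index_normalizer, hL36, hk] at h9
    have h10 : Nat.card (Subgroup.normalizer (P : Set (even x y))) = 14 * 2 ^ k := by omega
    rw [h10, ← Nat.Prime.coprime_iff_not_dvd (by norm_num)]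
    exact Nat.Coprime.mul_right (by norm_num) (Nat.Coprime.pow_right _ (by norm_num))
  have hw : (x * y) ^ 2 ∈ even x y := by
    have h1 : (x * y) ^ 2 = x * y * x⁻¹ * y := by rw [h.inv_x, pow_two]; group
    rw [h1]; exact mul_mem conj_mem y_mem
  have hz := Sylow.sq_mem_center k hperf hk hL36 (w := ⟨_, hw⟩) (Subtype.ext (by
    change ((x * y) ^ 2) ^ 4 = 1
    rw [← pow_mul, h.pow_eight]))
  let Z := (Subgroup.center (even x y)).map (even x y).subtype
  have hZ4 : (x * y) ^ 4 ∈ Z := ⟨_, hz, by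
    change ((x * y) ^ 2) ^ 2 = _
    rw [← pow_mul]⟩
  have hZn : Z.Normal := inferInstance
  obtain ⟨n, hn⟩ := (h.map (QuotientGroup.mk'_surjective Z)).card_dvd_of_pow_four (by
    rw [← map_mul, ← map_pow, ← MonoidHom.mem_ker, QuotientGroup.ker_mk']
    exact hZ4)
  have h7 : 7 ∣ Nat.card (Subgroup.center (even x y)) := by
    have h1 := Subgroup.card_eq_card_quotient_mul_card_subgroup Z
    have h2 : Nat.card Z = Nat.card (Subgroup.center (even x y)) :=
      Subgroup.card_map_of_injective Subtype.val_injective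
    have h3 : 7 ∣ Nat.card (G ⧸ Z) * Nat.card Z := by rw [← h1, hc]; norm_num
    rw [← h2]
    refine ((Nat.Prime.dvd_mul (by norm_num)).1 h3).resolve_left (fun h4 => ?_)
    have h5 := h4.trans hn
    have := (Nat.Coprime.pow_right n (by norm_num : Nat.Coprime 7 2)).dvd_of_dvd_mul_left h5
    omega
  obtain ⟨⟨c, hcZ⟩, hco⟩ := exists_prime_orderOf_dvd_card' 7 h7
  have hco' : orderOf c = 7 := by rw [← hco]; exact (Subgroup.orderOf_mk c hcZ).symm
  obtain ⟨P, hP⟩ := (IsPGroup.of_card (p := 7) (n := 1) (G := Subgroup.zpowers c)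
    (by rw [Nat.card_zpowers, hco']; norm_num)).exists_le_sylow
  have hcomm := Sylow.commute_of_card_prime (hcard P)
  have h1 := P.eq_one_of_commute_normalizer hcomm
    (MonoidHom.map_eq_one_of_commutator_eq_top
      (fun a b => Subtype.ext (hcomm a a.2 b b.2)) hperf) (hP (Subgroup.mem_zpowers c))
    (fun n _ => Subgroup.mem_center_iff.1 hcZ n)
  rw [h1] at hco'
  simp at hco'

end IsTriangleGen

/-! ### Order 2016: eight Sylow 7-subgroups -/

theorem exists_subgroup_dihedral {G : Type*} [Group G] {z s : G} (hz8 : z ^ 8 = 1)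
    (hz4 : z ^ 4 ≠ 1) (hs : s ^ 2 = 1) (hsz : s * z * s * z = 1)
    (hsn : s ∉ Subgroup.zpowers z) :
    ∃ H : Subgroup G, Nat.card H = 16 ∧
      ∀ g, g ∈ H ↔ g ∈ Subgroup.zpowers z ∨ g * s ∈ Subgroup.zpowers z := by
  have hss : s * s = 1 := by rw [← pow_two, hs]
  have hsi : s⁻¹ = s := (eq_inv_of_mul_eq_one_left hss).symm
  have hconj : ∀ g ∈ Subgroup.zpowers z, s * g * s ∈ Subgroup.zpowers z := by
    rintro _ ⟨n, rfl⟩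
    have h1 : s * z * s⁻¹ = z⁻¹ := by
      rw [hsi]; exact eq_inv_of_mul_eq_one_left hsz
    have h2 := conj_zpow (i := n) (a := s) (b := z)
    rw [h1, hsi] at h2
    change s * z ^ n * s ∈ _
    rw [← h2]
    exact zpow_mem (inv_mem (Subgroup.mem_zpowers z)) n
  let H : Subgroup G :=
    { carrier := {g | g ∈ Subgroup.zpowers z ∨ g * s ∈ Subgroup.zpowers z}
      one_mem' := Or.inl (one_mem _)
      mul_mem' := by
        rintro a b (ha | ha) (hb | hb)
        · exact Or.inl (mul_mem ha hb)
        · right; rw [mul_assoc]; exact mul_mem ha hb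
        · right
          have : a * b * s = a * s * (s * b * s) := by
            calc _ = a * 1 * b * s := by group
              _ = _ := by rw [← hss]; group
          rw [this]; exact mul_mem ha (hconj b hb)
        · left
          have : a * b = a * s * (s * (b * s) * s) := by
            calc _ = a * 1 * b * 1 := by group
              _ = _ := by rw [← hss]; group
          rw [this]; exact mul_mem ha (hconj _ hb)
      inv_mem' := by
        rintro a (ha | ha)
        · exact Or.inl (inv_mem ha)
        · right
          have : a⁻¹ * s = s * (a * s)⁻¹ * s := by
            calc _ = (s * s⁻¹) * a⁻¹ * s := by group
              _ = _ := by rw [hsi, mul_inv_rev, hsi]; group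
          rw [this]; exact hconj _ (inv_mem ha) }
  have hH : ∀ g, g ∈ H ↔ g ∈ Subgroup.zpowers z ∨ g * s ∈ Subgroup.zpowers z := fun g => Iff.rfl
  refine ⟨H, ?_, hH⟩
  have hle : Subgroup.zpowers z ≤ H := fun g hg => Or.inl hg
  have hsH : s ∈ H := (hH s).2 (Or.inr (by rw [hss]; exact one_mem _))
  have h2 : ((Subgroup.zpowers z).subgroupOf H).index = 2 := by
    rw [Subgroup.index_eq_two_iff]
    refine ⟨⟨s, hsH⟩, fun g => ?_⟩
    simp only [Subgroup.mem_subgroupOf, Subgroup.coe_mul]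
    rw [xor_iff_or_and_not_and]
    refine ⟨((hH g).1 g.2).symm, fun ⟨h1, h2⟩ => hsn ?_⟩
    have := mul_mem (inv_mem h2) h1
    rwa [inv_mul_cancel_left] at this
  have h8 : orderOf z = 2 ^ 3 :=
    orderOf_eq_prime_pow (p := 2) (n := 2) (by norm_num [hz4]) (by norm_num [hz8])
  rw [← Subgroup.card_mul_index ((Subgroup.zpowers z).subgroupOf H), h2,
    Nat.card_congr (Subgroup.subgroupOfEquivOfLe hle).toEquiv, Nat.card_zpowers, h8]
  norm_num

theorem eq_one_of_smul_eq_of_mem_zpowers {G X : Type*} [Group G] [MulAction G X] {z g : G} {a : X}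
    (h8 : z ^ 8 = 1) (h4 : z ^ 4 • a ≠ a) (hg : g ∈ Subgroup.zpowers z) (hga : g • a = a) :
    g = 1 := by
  have hfin : IsOfFinOrder z := isOfFinOrder_iff_pow_eq_one.2 ⟨8, by norm_num, h8⟩
  rw [← hfin.mem_powers_iff_mem_zpowers] at hg
  obtain ⟨n, rfl⟩ := hg
  have h1 : z ^ n = z ^ (n % 8) := by
    conv_lhs => rw [← Nat.div_add_mod n 8, pow_add, pow_mul, h8, one_pow, one_mul]
  have h2 : n % 8 = 0 := by
    refine pow_smul_injOn h8 h4 (Nat.mod_lt _ (by norm_num)) (by norm_num : 0 < 8) ?_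
    rw [← h1, pow_zero, one_smul]
    exact hga
  change z ^ n = 1
  rw [h1, h2, pow_zero]

set_option synthInstance.maxSize 2000 in
set_option synthInstance.maxHeartbeats 200000 in
theorem rot8_solutions_aux : ∀ v1 v6 : Fin 8, v6 = v1 + 1 →
    v1 ≠ 0 → v1 ≠ 7 → v6 ≠ 0 → v6 ≠ 7 → (v1 = 6 ↔ v6 = 1) →
    ∀ v2 : Fin 8, v2 ≠ 0 → v2 ≠ 7 → (v2 = 1 ↔ v1 = 2) → (v2 = 6 ↔ v6 = 2) →
    ∀ v3 : Fin 8, v3 ≠ 0 → v3 ≠ 7 → (v3 = 1 ↔ v1 = 3) → (v3 = 6 ↔ v6 = 3) → (v3 = 2 ↔ v2 = 3) →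
    ∀ v4 v5 : Fin 8,
    (∀ i, ![7, v1, v2, v3, v4, v5, v6, 0] (![7, v1, v2, v3, v4, v5, v6, 0] i) = i) →
    (∀ i, ![7, v1, v2, v3, v4, v5, v6, 0] (![7, v1, v2, v3, v4, v5, v6, 0]
      (![7, v1, v2, v3, v4, v5, v6, 0] (i + 1) + 1) + 1) = i) →
    (![7, v1, v2, v3, v4, v5, v6, 0] = (![7, 1, 6, 3, 5, 4, 2, 0] : Fin 8 → Fin 8)) ∨
    (![7, v1, v2, v3, v4, v5, v6, 0] = (![7, 5, 3, 2, 4, 1, 6, 0] : Fin 8 → Fin 8)) ∨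
    (![7, v1, v2, v3, v4, v5, v6, 0] = (![7, 2, 1, 6, 4, 5, 3, 0] : Fin 8 → Fin 8)) ∨
    (![7, v1, v2, v3, v4, v5, v6, 0] = (![7, 4, 2, 3, 1, 6, 5, 0] : Fin 8 → Fin 8)) ∨
    (![7, v1, v2, v3, v4, v5, v6, 0] = (![7, 1, 6, 4, 3, 5, 2, 0] : Fin 8 → Fin 8)) ∨
    (![7, v1, v2, v3, v4, v5, v6, 0] = (![7, 5, 2, 4, 3, 1, 6, 0] : Fin 8 → Fin 8)) := by
  decide

/-- Here `f` is x and `i ↦ i + 1` is z; `f 0 = 7` says that y fixes label 7. Only the last two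
solutions commute with z⁴. -/
theorem rot8_solutions (f : Fin 8 → Fin 8) (hf : ∀ i, f (f i) = i) (h0 : f 0 = 7)
    (h3 : ∀ i, f (f (f (i + 1) + 1) + 1) = i) :
    f = ![7, 1, 6, 3, 5, 4, 2, 0] ∨ f = ![7, 5, 3, 2, 4, 1, 6, 0] ∨
    f = ![7, 2, 1, 6, 4, 5, 3, 0] ∨ f = ![7, 4, 2, 3, 1, 6, 5, 0] ∨
    f = ![7, 1, 6, 4, 3, 5, 2, 0] ∨ f = ![7, 5, 2, 4, 3, 1, 6, 0] := by
  have h7 : f 7 = 0 := by rw [← h0, hf]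
  have h6 : f 6 = f 1 + 1 := by
    have := h3 6
    rw [show (6 : Fin 8) + 1 = 7 from rfl, h7, show (0 : Fin 8) + 1 = 1 from rfl] at this
    rw [← this, hf]
  have key : f = ![7, f 1, f 2, f 3, f 4, f 5, f 6, 0] := by
    ext i
    fin_cases i <;> simp [*]
  have hinj : ∀ i j, i ≠ j → f i ≠ f j := fun i j hij h => hij (by rw [← hf i, h, hf])
  have hsymm : ∀ i j, f i = j ↔ f j = i := fun i j =>
    ⟨fun h => by rw [← h, hf], fun h => by rw [← h, hf]⟩
  have hn0 : ∀ i, i ≠ 7 → f i ≠ 0 := fun i hi => h7 ▸ hinj i 7 hi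
  have hn7 : ∀ i, i ≠ 0 → f i ≠ 7 := fun i hi => h0 ▸ hinj i 0 hi
  rw [key]
  refine rot8_solutions_aux _ _ h6 (hn0 _ (by decide)) (hn7 _ (by decide)) (hn0 _ (by decide))
    (hn7 _ (by decide)) (hsymm _ _) _ (hn0 _ (by decide)) (hn7 _ (by decide)) (hsymm _ _)
    (hsymm _ _) _ (hn0 _ (by decide)) (hn7 _ (by decide)) (hsymm _ _)
    (hsymm _ _) (hsymm _ _) _ _ ?_ ?_ <;> rw [← key]
  · exact hf
  · exact h3

namespace IsTriangleGen

variable {G : Type*} [Group G] [Finite G] {x y : G}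

/-- Otherwise the image is a quotient of the (2,3,4) group, yet `e` has image of order 7. -/
theorem pow_four_smul_ne {X : Type*} [MulAction G X] (h : IsTriangleGen x y) {e : G}
    (he7 : e ^ 7 = 1) (he : ∃ A : X, e • A ≠ A) : ∃ a : X, (x * y) ^ 4 • a ≠ a := by
  by_contra! hcon
  have hr := h.map (toPermHom G X).rangeRestrict_surjective
  have : Finite (toPermHom G X).range := Finite.of_surjective _ (toPermHom G X).rangeRestrict_surjective
  obtain ⟨n, hn⟩ := hr.card_dvd_of_pow_four (by
    rw [← map_mul, ← map_pow]
    apply Subtype.ext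
    ext a
    exact hcon a)
  have f7 : Fact (Nat.Prime 7) := ⟨by norm_num⟩
  have h1 : orderOf ((toPermHom G X).rangeRestrict e) = 7 := by
    refine orderOf_eq_prime (by rw [← map_pow, he7, map_one]) fun h1 => ?_
    obtain ⟨A, hA⟩ := he
    exact hA (Equiv.ext_iff.1 (congrArg Subtype.val h1) A)
  have h7 : 7 ∣ 2 ^ n * 6 := (h1 ▸ orderOf_dvd_natCard _).trans hn
  have : 7 ∣ 6 := (Nat.Coprime.pow_right n (by norm_num : Nat.Coprime 7 2)).dvd_of_dvd_mul_left h7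
  omega

theorem exists_equiv_of_card_eq_eight {G X : Type*} [Group G] [MulAction G X] (hX : Nat.card X = 8)
    {z : G} (hz8 : z ^ 8 = 1) {a : X} (ha : z ^ 4 • a ≠ a) :
    ∃ E : Fin 8 ≃ X, (∀ i : Fin 8, E i = z ^ (i : ℕ) • a) ∧ ∀ i, z • E i = E (i + 1) := by
  have : Finite X := Nat.finite_of_card_ne_zero (by rw [hX]; norm_num)
  have hinj : Function.Injective fun i : Fin 8 => z ^ (i : ℕ) • a := fun i j hij =>
    Fin.ext (pow_smul_injOn hz8 ha i.2 j.2 hij)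
  refine ⟨Equiv.ofBijective _ (hinj.bijective_of_nat_card_le (by rw [hX]; simp)),
    fun i => rfl, fun i => ?_⟩
  simp only [Equiv.ofBijective_apply]
  fin_cases i <;> simp [← mul_smul, ← pow_succ', ← pow_two, hz8]

/-- In a suitable action of degree `8`, some conjugate of the involution `x` inverts `x * y`. -/
theorem exists_conj_of_card_eq_eight {X : Type*} [MulAction G X] (h : IsTriangleGen x y)
    (hX : Nat.card X = 8) {e : G} {P : X} (he7 : e ^ 7 = 1) (heP : e • P = P)
    (he : ∀ A : X, e • A = A → A = P) :
    (∀ a : X, (x * y) ^ 4 • a ≠ a) ∧ (∃ E : Fin 8 ≃ X, ∀ i, (x * y) • E i = E (i + 1)) ∧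
    ∃ g w : G, (∃ a : X, (g * x * g⁻¹) • a = a) ∧ (∃ a : X, (g * x * g⁻¹) • a ≠ a) ∧
      ∀ a : X, (w * (g * x * g⁻¹) * (x * y)) • a = ((x * y) ^ 4 * w) • a := by
  have : Finite X := Nat.finite_of_card_ne_zero (by rw [hX]; norm_num)
  obtain ⟨p, hp⟩ := h.pow_four_smul_ne (X := X) he7 (by
    by_contra! hcon
    have : Subsingleton X := ⟨fun A B => (he A (hcon A)).trans (he B (hcon B)).symm⟩
    have := Finite.card_le_one_iff_subsingleton.2 this
    omega)
  set z := x * y with hz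
  have hz8 : z ^ 8 = 1 := h.pow_eight
  have hyz : ∀ a : X, y • a = x • z • a := by
    intro a
    rw [← mul_smul, hz, ← mul_assoc, h.xx, one_mul]
  have hxx : ∀ a : X, x • x • a = a := by
    intro a
    rw [← mul_smul, h.xx, one_smul]
  have hz4 : ∀ a : X, z ^ 4 • a ≠ a := by
    obtain ⟨E, hE, -⟩ := exists_equiv_of_card_eq_eight hX hz8 hp
    intro a ha
    obtain ⟨i, rfl⟩ := E.surjective a
    rw [hE, ← mul_smul, ← pow_add, add_comm, pow_add, mul_smul] at ha
    exact hp (smul_left_cancel _ ha)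
  obtain ⟨B, hB⟩ : ∃ B : X, y • B = B := by
    have h2 : IsPGroup 3 (Subgroup.zpowers y) := by
      apply IsPGroup.of_card_dvd_pow (n := 1)
      rw [Nat.card_zpowers]
      exact orderOf_dvd_of_pow_eq_one (by rw [pow_one, h.cube])
    have f3 : Fact (Nat.Prime 3) := ⟨by norm_num⟩
    obtain ⟨q, hq⟩ := h2.nonempty_fixed_point_of_prime_not_dvd_card X (by rw [hX]; norm_num)
    exact ⟨q, hq ⟨y, Subgroup.mem_zpowers y⟩⟩
  obtain ⟨E, hE, hEz⟩ := exists_equiv_of_card_eq_eight hX hz8 (hz4 (z • B))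
  have hE7 : E 7 = B := by
    rw [hE, ← mul_smul, ← pow_succ]
    exact (congrArg (· • B) hz8).trans (one_smul _ _)
  obtain ⟨f, hfx⟩ : ∃ f : Fin 8 → Fin 8, ∀ i, x • E i = E (f i) :=
    ⟨fun i => E.symm (x • E i), fun i => by simp⟩
  have hfy : ∀ i, y • E i = E (f (i + 1)) := fun i => by rw [hyz, hEz, hfx]
  have hEzi : ∀ i, z⁻¹ • E i = E (i + 7) := fun i => by
    rw [inv_smul_eq_iff, hEz, add_assoc]
    exact congrArg E (add_zero i).symm
  have hf := rot8_solutions f (fun i => E.injective (by rw [← hfx, ← hfx, hxx]))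
    (E.injective (by rw [show (0 : Fin 8) = 7 + 1 from rfl, ← hfy, hE7, hB]))
    (fun i => E.injective (by
      rw [← hfy, ← hfy, ← hfy, ← mul_smul, ← mul_smul, ← pow_two, ← pow_succ, h.cube, one_smul]))
  -- If z⁴ commuted with the action, it would preserve the fixed points of `e`, hence fix `P`.
  have hcentral : ¬ ∀ i, f (i + 4) = f i + 4 := by
    intro hcon
    have hz4E : ∀ i, z ^ 4 • E i = E (i + 4) := by
      intro i
      simp only [pow_succ, pow_zero, one_mul, mul_smul, hEz, add_assoc]
      rfl
    have key : ∀ g : G, ∀ a : X, g • z ^ 4 • a = z ^ 4 • g • a := by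
      have hx : ∀ a : X, x • z ^ 4 • a = z ^ 4 • x • a := by
        intro a
        obtain ⟨i, rfl⟩ := E.surjective a
        rw [hz4E, hfx, hfx, hz4E, hcon]
      refine fun g => h.induction (p := fun g => ∀ a : X, g • z ^ 4 • a = z ^ 4 • g • a)
        hx ?_ ?_ ?_ ?_ g
      · intro a
        rw [hyz, hyz, ← hx, ← mul_smul z, ← mul_smul _ z, ← pow_succ, ← pow_succ']
      · intro a; rw [one_smul, one_smul]
      · intro a b ha hb c
        rw [mul_smul, hb, ha, mul_smul]
      · intro a ha b
        rw [inv_smul_eq_iff, ha, smul_inv_smul]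
    exact hz4 P (he _ (by rw [key, heP]))
  have finish : ∀ g w : G, (∃ j, x • E j = E j) → (∃ j, x • E j ≠ E j) →
      (∀ i, w • g • x • g⁻¹ • z • E i = z ^ 4 • w • E i) →
      ∃ g w : G, (∃ a : X, (g * x * g⁻¹) • a = a) ∧ (∃ a : X, (g * x * g⁻¹) • a ≠ a) ∧
      ∀ a : X, (w * (g * x * g⁻¹) * z) • a = (z ^ 4 * w) • a := by
    rintro g w ⟨i, hi⟩ ⟨j, hj⟩ hw
    refine ⟨g, w, ⟨g • E i, ?_⟩, ⟨g • E j, ?_⟩, fun a => ?_⟩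
    · rw [mul_smul, mul_smul, inv_smul_smul, hi]
    · rwa [mul_smul, mul_smul, inv_smul_smul, Ne, (MulAction.injective g).eq_iff]
    · obtain ⟨k, rfl⟩ := E.surjective a
      simp only [mul_smul, hw]
  refine ⟨hz4, ⟨E, hEz⟩, ?_⟩
  simp only [hfx, Ne, E.injective.eq_iff] at finish
  -- The words for `g` and `w` are explicit and checked on labels. With s the conjugate of x by `g`,
  -- they make sz conjugate to z⁴ in the action, so (sz)² = 1 there and s inverts z.
  rcases hf with rfl | rfl | rfl | rfl | rfl | rfl
  iterate 2
    refine finish (x * z ^ 4) (x * z ^ 3 * x * z ^ 2) (by decide) (by decide) fun i => ?_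
    simp only [pow_succ, pow_zero, one_mul, mul_smul, mul_inv_rev, h.inv_x, hfx, hEz, hEzi]
    exact congrArg E (by revert i; decide)
  iterate 2
    refine finish (x * z ^ 3 * x * z) (x * z ^ 4 * x) (by decide) (by decide) fun i => ?_
    simp only [pow_succ, pow_zero, one_mul, mul_smul, mul_inv_rev, h.inv_x, hfx, hEz, hEzi]
    exact congrArg E (by revert i; decide)
  · exact absurd (by decide) hcentral
  · exact absurd (by decide) hcentral

end IsTriangleGen

/-- The factor `k` allows for a relation that lifts from a permutation group only up to a central
involution. -/
theorem sq_eq_one_of_mul_eq {G : Type*} [Group G] {s w z k : G} (hk : ∀ g, k * g = g * k)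
    (hk2 : k * k = 1) (hz8 : z ^ 8 = 1) (h : w * s * z = k * z ^ 4 * w) : s * z * s * z = 1 := by
  have h1 : s * z = w⁻¹ * (k * z ^ 4 * w) := by rw [← h]; group
  calc s * z * s * z = s * z * (s * z) := by group
    _ = w⁻¹ * k * (z ^ 4 * k) * z ^ 4 * w := by rw [h1]; group
    _ = w⁻¹ * (k * k) * (z ^ 4 * z ^ 4) * w := by rw [← hk (z ^ 4)]; simp only [mul_assoc]
    _ = 1 := by rw [hk2, ← pow_add, hz8]; group

/-- `P` is regular on the other seven Sylow subgroups, so anything centralising `P` acts there as an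
element of `P`. The centraliser thus has at most 7 times the kernel's order, and its index in the
normaliser is at most 6. -/
theorem Sylow.card_le_card_ker_toPermHom {G : Type*} [Group G] [Finite G] {P : Sylow 7 G}
    (hcard : ∀ P : Sylow 7 G, Nat.card (P : Subgroup G) = 7) (h8 : Nat.card (Sylow 7 G) = 8) :
    Nat.card (Subgroup.normalizer (P : Set G)) ≤ 42 * Nat.card (toPermHom G (Sylow 7 G)).ker := by
  have f7 : Fact (Nat.Prime 7) := ⟨by norm_num⟩
  have hP := hcard P
  let K := (toPermHom G (Sylow 7 G)).ker
  let ψ := (P : Subgroup G).normalizerMonoidHom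
  have := isCyclic_of_prime_card hP
  have h6 : Nat.card (MulAut (P : Subgroup G)) = 6 := by
    rw [IsCyclic.card_mulAut, hP]; rfl
  have : Finite (MulAut (P : Subgroup G)) := Nat.finite_of_card_ne_zero (by rw [h6]; norm_num)
  have hr : Nat.card ψ.range ≤ 6 := h6 ▸ Finite.card_subtype_le _
  have hidx := Subgroup.card_mul_index ψ.ker
  rw [Subgroup.index_ker] at hidx
  obtain ⟨A₁, hA₁⟩ : ∃ A : Sylow 7 G, A ≠ P := by
    by_contra! hcon
    have : Subsingleton (Sylow 7 G) := ⟨fun A B => (hcon A).trans (hcon B).symm⟩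
    have := Finite.card_le_one_iff_subsingleton.2 this
    omega
  have htrans : ∀ A : Sylow 7 G, A ≠ P → ∃ a ∈ P, a • A₁ = A := by
    have hne : ∀ a ∈ P, ∀ A : Sylow 7 G, A ≠ P → a • A ≠ P := by
      intro a ha A hA h
      rw [← self_smul ha] at h
      exact hA (smul_left_cancel _ h)
    let F : ↥(P : Subgroup G) → {A : Sylow 7 G // A ≠ P} := fun a => ⟨a.1 • A₁, hne _ a.2 _ hA₁⟩
    have hF : Function.Injective F := by
      intro a b hab
      have h1 : a.1 • A₁ = b.1 • A₁ := congrArg Subtype.val hab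
      by_contra hne
      refine hA₁ (eq_of_smul_eq hcard (a := b.1⁻¹ * a.1) (mul_mem (inv_mem b.2) a.2) ?_ ?_)
      · rw [mul_smul, h1, inv_smul_smul]
      · intro h2
        exact hne (Subtype.ext (inv_mul_eq_one.1 h2).symm)
    have hcc : Nat.card {A : Sylow 7 G // A ≠ P} = 7 := by
      have h1 := Set.ncard_compl ({P} : Set (Sylow 7 G))
      rw [h8, Set.ncard_singleton] at h1
      exact h1
    intro A hA
    obtain ⟨a, ha⟩ := (hF.bijective_of_nat_card_le (by rw [hcc]; exact hP.ge)).2 ⟨A, hA⟩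
    exact ⟨a, a.2, congrArg Subtype.val ha⟩
  have hker : ∀ c : ψ.ker, ∃ q : ↥(P : Subgroup G) × K, q.1.1 * q.2.1 = c.1.1 := by
    rintro ⟨⟨c, hcN⟩, hc⟩
    have hcP : ∀ a ∈ P, c * a = a * c := by
      intro a ha
      have := congrArg Subtype.val (DFunLike.congr_fun (MonoidHom.mem_ker.1 hc) ⟨a, ha⟩)
      exact mul_inv_eq_iff_eq_mul.1 this
    have hcA : c • P = P := smul_eq_iff_mem_normalizer.2 hcN
    obtain ⟨a, ha, hac⟩ := htrans (c • A₁) (fun h => hA₁ (by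
      rw [← hcA] at h; exact smul_left_cancel _ h))
    refine ⟨⟨⟨a, ha⟩, ⟨a⁻¹ * c, ?_⟩⟩, mul_inv_cancel_left _ _⟩
    refine MonoidHom.mem_ker.2 (Equiv.ext fun A => ?_)
    change (a⁻¹ * c) • A = A
    by_cases hA : A = P
    · rw [hA, mul_smul, hcA, self_smul (inv_mem ha)]
    · obtain ⟨b, hb, rfl⟩ := htrans A hA
      have hab : a⁻¹ * c * b = b * (a⁻¹ * c) := by
        rw [mul_assoc, hcP b hb, ← mul_assoc, ← mul_assoc,
          commute_of_card_prime hP _ (inv_mem ha) b hb]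
      rw [← mul_smul, hab, mul_smul, mul_smul, ← hac, inv_smul_smul]
  choose q hq using hker
  have hqi : Function.Injective q := fun c d h =>
    Subtype.ext (Subtype.ext (by rw [← hq, h, hq]))
  have h1 := Nat.card_le_card_of_injective q hqi
  rw [Nat.card_prod, hP] at h1
  refine hidx.ge.trans ?_
  calc _ ≤ (7 * Nat.card K) * 6 := Nat.mul_le_mul h1 hr
    _ = _ := by ring

namespace IsTriangleGen

variable {G : Type*} [Group G] [Finite G] {x y : G}

/-- 336 = 7 · 3 · 16, the 16 from a dihedral subgroup: the conjugate of x fixes a point without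
being trivial, so it is not a power of the semiregular z. -/
theorem dvd_card_range_toPermHom {X : Type*} [MulAction G X] (h : IsTriangleGen x y) {e g w : G}
    (he7 : e ^ 7 = 1) (he : ∃ A : X, e • A ≠ A) (hz4 : ∀ a : X, (x * y) ^ 4 • a ≠ a)
    (hg : ∃ a : X, (g * x * g⁻¹) • a = a) (hg' : ∃ a : X, (g * x * g⁻¹) • a ≠ a)
    (hw : ∀ a : X, (w * (g * x * g⁻¹) * (x * y)) • a = ((x * y) ^ 4 * w) • a) :
    336 ∣ Nat.card (toPermHom G X).range := by
  let τ := (toPermHom G X).rangeRestrict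
  have hτ : ∀ {g g' : G}, τ g = τ g' ↔ ∀ a : X, g • a = g' • a := fun {g g'} =>
    ⟨fun h a => Equiv.ext_iff.1 (congrArg Subtype.val h) a, fun h => Subtype.ext (Equiv.ext h)⟩
  have hτ1 : ∀ {g : G}, τ g = 1 ↔ ∀ a : X, g • a = a := fun {g} => by
    rw [← map_one τ, hτ]; simp
  have hr : IsTriangleGen (τ x) (τ y) := h.map (toPermHom G X).rangeRestrict_surjective
  have : Finite (toPermHom G X).range :=
    Finite.of_surjective _ (toPermHom G X).rangeRestrict_surjective
  obtain ⟨a, ha⟩ := hg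
  obtain ⟨b, hb⟩ := hg'
  have h7 : 7 ∣ Nat.card (toPermHom G X).range := by
    have f7 : Fact (Nat.Prime 7) := ⟨by norm_num⟩
    have h1 : orderOf (τ e) = 7 := by
      refine orderOf_eq_prime (by rw [← map_pow, he7, map_one]) fun h1 => ?_
      obtain ⟨A, hA⟩ := he
      exact hA (hτ1.1 h1 A)
    exact h1 ▸ orderOf_dvd_natCard _
  have h3 : 3 ∣ Nat.card (toPermHom G X).range := by
    have f3 : Fact (Nat.Prime 3) := ⟨by norm_num⟩
    have h1 : orderOf (τ y) = 3 := by
      refine orderOf_eq_prime hr.cube fun h1 => ?_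
      have h2 := hr.card_dvd_six (by rw [h1, mul_one, hr.sq])
      have := h7.trans h2
      omega
    exact h1 ▸ orderOf_dvd_natCard _
  have h16 : 16 ∣ Nat.card (toPermHom G X).range := by
    have hz8 : τ (x * y) ^ 8 = 1 := by rw [map_mul, hr.pow_eight]
    obtain ⟨H, hH, -⟩ := exists_subgroup_dihedral (z := τ (x * y)) (s := τ (g * x * g⁻¹)) hz8
      (by rw [← map_pow, Ne, hτ1]; exact fun h1 => hz4 a (h1 a))
      (by rw [← map_pow, conj_pow, h.sq, mul_one, mul_inv_cancel, map_one])
      (sq_eq_one_of_mul_eq (w := τ w) (k := 1) (by simp) (by simp) hz8 (by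
        rw [one_mul, ← map_pow, ← map_mul, ← map_mul, ← map_mul, hτ]
        exact hw))
      (fun hs => hb (hτ1.1 (eq_one_of_smul_eq_of_mem_zpowers (a := a) hz8 (by
        rw [← map_pow]; exact hz4 a) hs ha) b))
    exact hH ▸ Subgroup.card_subgroup_dvd_card H
  have h21 := Nat.Coprime.mul_dvd_of_dvd_of_dvd (by norm_num) h7 h3
  exact Nat.Coprime.mul_dvd_of_dvd_of_dvd (by norm_num : Nat.Coprime (7 * 3) 16) h21 h16

end IsTriangleGen

theorem Subgroup.exists_normal_of_card_eq_six {G : Type*} [Group G] [Finite G] {K : Subgroup G}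
    [K.Normal] (hK : Nat.card K = 6) :
    ∃ N : Subgroup G, N.Normal ∧ N ≤ K ∧ Nat.card N = 3 ∧ ∃ k ∈ K, k * k = 1 ∧ k ∉ N := by
  have f3 : Fact (Nat.Prime 3) := ⟨by norm_num⟩
  obtain ⟨Q⟩ : Nonempty (Sylow 3 K) := inferInstance
  have hQ : Nat.card (Q : Subgroup K) = 3 := by
    simpa using Q.card_eq_of_card_eq (n := 1) (m := 2) (by rw [hK]; norm_num) (by norm_num)
  have h1 : Nat.card (Sylow 3 K) ∣ 2 := by
    have h2 := Subgroup.card_mul_index (Q : Subgroup K)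
    rw [hQ, hK] at h2
    have h3 := Q.card_dvd_index
    rwa [show (Q : Subgroup K).index = 2 by omega] at h3
  have h2 := card_sylow_modEq_one 3 K
  have h3 : Nat.card (Sylow 3 K) = 1 := by
    rcases (Nat.dvd_prime Nat.prime_two).1 h1 with h | h
    · exact h
    · rw [h] at h2; exact absurd h2 (by decide)
  have := (Nat.card_eq_one_iff_unique.1 h3).1
  have := Q.characteristic_of_subsingleton
  refine ⟨(Q : Subgroup K).map K.subtype, inferInstance, Subgroup.map_subtype_le _, ?_, ?_⟩
  · rw [Subgroup.card_map_of_injective K.subtype_injective, hQ]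
  · obtain ⟨k, hk⟩ := exists_prime_orderOf_dvd_card' 2 (by rw [hK]; norm_num : 2 ∣ Nat.card K)
    have hk2 : k ^ 2 = 1 := hk ▸ pow_orderOf_eq_one k
    refine ⟨k, k.2, ?_, ?_⟩
    · rw [← pow_two]; exact congrArg Subtype.val hk2
    · rw [Subgroup.mem_map]
      rintro ⟨k', hk', h⟩
      have h4 : k' = k := Subtype.ext h
      have h5 : k = 1 := eq_one_of_pow_coprime hk2
        (Subgroup.pow_eq_one_of_card_eq hQ (h4 ▸ hk')) (by norm_num)
      rw [h5, orderOf_one] at hk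
      omega

namespace IsTriangleGen

variable {G : Type*} [Group G] [Finite G] {x y : G}

/-- Every sign character kills y, so it is determined by its value at x. -/
theorem eq_of_map_x_eq_neg_one {G : Type*} [Group G] {x y : G} (h : IsTriangleGen x y) {f f' : G →* ℤˣ} (hf : f x = -1)
    (hf' : f' ≠ 1) : f = f' := by
  refine h.hom_ext ?_ (by rw [h.map_y_eq_one, h.map_y_eq_one])
  rw [hf]
  rcases Int.units_eq_one_or (f' x) with h1 | h1
  · exact absurd (h.hom_ext h1 (h.map_y_eq_one f')) hf'
  · exact h1.symm

/-- In an action of degree `8` whose kernel has order `6`, an element of order `2` of the kernel maps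
to a central involution of a quotient of order `672`; that involution is an odd permutation of the
`42` cosets of a dihedral subgroup, but acts trivially in the given action. -/
theorem card_ker_toPermHom_ne_six {X : Type*} [MulAction G X] (h : IsTriangleGen x y)
    (hc : Nat.card G = 2016) {g w : G} (hz4 : ∀ a : X, (x * y) ^ 4 • a ≠ a)
    (hE : ∃ E : Fin 8 ≃ X, ∀ i, (x * y) • E i = E (i + 1))
    (hg : ∃ a : X, (g * x * g⁻¹) • a = a) (hg' : ∃ a : X, (g * x * g⁻¹) • a ≠ a)
    (hw : ∀ a : X, (w * (g * x * g⁻¹) * (x * y)) • a = ((x * y) ^ 4 * w) • a) :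
    Nat.card (toPermHom G X).ker ≠ 6 := by
  classical
  intro hK
  obtain ⟨N, hN, hNK, hN3, k, hkK, hk2, hkN⟩ := Subgroup.exists_normal_of_card_eq_six hK
  obtain ⟨E, hE⟩ := hE
  obtain ⟨a, ha⟩ := hg
  obtain ⟨b, hb⟩ := hg'
  have : Fintype X := Fintype.ofEquiv _ E
  set z := x * y with hz
  set s := g * x * g⁻¹ with hs
  have hz8 : z ^ 8 = 1 := h.pow_eight
  have hker : ∀ {u : G}, u ∈ (toPermHom G X).ker ↔ ∀ a : X, u • a = a := fun {u} =>
    MonoidHom.mem_ker.trans Equiv.ext_iff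
  have hKK : ∀ u ∈ (toPermHom G X).ker, u ∈ N ∨ k * u ∈ N := by
    intro u hu
    by_cases huN : u ∈ N
    · exact Or.inl huN
    · refine Or.inr ((Subgroup.mul_mem_iff_of_card_eq_two_mul hNK (by rw [hK, hN3]) hkK hu).2 ?_)
      exact iff_of_false hkN huN
  let π := QuotientGroup.mk' N
  have hπ : ∀ {u : G}, π u = 1 ↔ u ∈ N := fun {u} => QuotientGroup.eq_one_iff u
  have hcc : π k * π k = 1 := by rw [← map_mul, hk2, map_one]
  have hπK : ∀ u ∈ (toPermHom G X).ker, π u = 1 ∨ π u = π k := by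
    intro u hu
    refine (hKK u hu).imp hπ.2 fun h1 => ?_
    rw [← hπ, map_mul] at h1
    rw [← mul_left_cancel_iff (a := π k), h1, hcc]
  have hcent : ∀ u : G ⧸ N, π k * u = u * π k := by
    intro u
    obtain ⟨u, rfl⟩ := QuotientGroup.mk'_surjective N u
    rcases hπK _ ((MonoidHom.normal_ker _).conj_mem k hkK u) with h1 | h1
    · rw [hπ] at h1
      exact absurd (by simpa [mul_assoc] using hN.mem_comm h1) hkN
    · change π k * π u = π u * π k
      rw [map_mul, map_mul, map_inv] at h1
      exact (mul_inv_eq_iff_eq_mul.1 h1).symm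
  -- `N` acts trivially, so the power of z matching `u` modulo `N` also fixes `a`; by semiregularity
  -- it is 1.
  have hfix : ∀ u : G, ∀ a : X, u • a = a → π u ∈ Subgroup.zpowers (π z) → u ∈ N := by
    rintro u a hu ⟨n, hn⟩
    have h1 : u⁻¹ * z ^ n ∈ N := by
      rw [← hπ, map_mul, map_inv, map_zpow]
      exact inv_mul_eq_one.2 hn.symm
    have h2 : z ^ n • a = a := by
      have := hker.1 (hNK h1) a
      rwa [mul_smul, inv_smul_eq_iff, hu] at this
    have h3 := eq_one_of_smul_eq_of_mem_zpowers hz8 (hz4 a) ⟨n, rfl⟩ h2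
    rw [← hπ, ← hn]
    exact (map_zpow π z n).symm.trans ((congrArg π h3).trans (map_one π))
  have hsN : s ∉ (toPermHom G X).ker := fun h1 => hb (hker.1 h1 b)
  have hs2 : s ^ 2 = 1 := by rw [hs, conj_pow, h.sq, mul_one, mul_inv_cancel]
  have hπz8 : π z ^ 8 = 1 := by rw [← map_pow, hz8, map_one]
  -- The relation between s, z and w holds modulo the kernel, whose image in the quotient is 1 and
  -- the central involution `π k`.
  have hdih : π s * π z * π s * π z = 1 := by
    have h1 : w * s * z * (z ^ 4 * w)⁻¹ ∈ (toPermHom G X).ker := hker.2 fun a => by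
      rw [mul_smul, hw, smul_inv_smul]
    have h2 : π w * π s * π z = π (w * s * z * (z ^ 4 * w)⁻¹) * π z ^ 4 * π w := by
      simp only [← map_mul, ← map_pow]
      congr 1
      group
    rcases hπK _ h1 with h3 | h3 <;> rw [h3] at h2
    · exact sq_eq_one_of_mul_eq (by simp) (by simp) hπz8 h2
    · exact sq_eq_one_of_mul_eq hcent hcc hπz8 h2
  obtain ⟨H, hH, hHmem⟩ := exists_subgroup_dihedral (z := π z) (s := π s) hπz8
    (by
      rw [← map_pow, Ne, hπ]
      exact fun h1 => hz4 a (hker.1 (hNK h1) a))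
    (by rw [← map_pow, hs2, map_one]) hdih (fun h1 => hsN (hNK (hfix s a ha h1)))
  have hcH : π k ∉ H := by
    rw [hHmem]
    rintro (h1 | h1)
    · exact hkN (hfix k a (hker.1 hkK a) h1)
    · rw [← map_mul] at h1
      have h2 := hNK (hfix (k * s) a (by rw [mul_smul, ha, hker.1 hkK]) h1)
      exact hsN ((Subgroup.mul_mem_cancel_left _ hkK).1 h2)
  have h42 : Nat.card ((G ⧸ N) ⧸ H) = 42 := by
    have h1 := Subgroup.card_eq_card_quotient_mul_card_subgroup N
    have h2 := Subgroup.card_eq_card_quotient_mul_card_subgroup H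
    rw [hc, hN3] at h1
    rw [hH] at h2
    omega
  have := Fintype.ofFinite ((G ⧸ N) ⧸ H)
  have hfree : Nat.card (fixedBy ((G ⧸ N) ⧸ H) (π k)) = 0 := by
    have : IsEmpty (fixedBy ((G ⧸ N) ⧸ H) (π k)) := by
      refine ⟨fun ⟨q, hq⟩ => ?_⟩
      obtain ⟨u, rfl⟩ := QuotientGroup.mk_surjective q
      have h1 : u⁻¹ * (π k * u) ∈ H := QuotientGroup.eq.1 (Eq.symm hq)
      rw [hcent, inv_mul_cancel_left] at h1
      exact hcH h1
    exact Nat.card_of_isEmpty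
  let f : G →* ℤˣ := Equiv.Perm.sign.comp (toPermHom G X)
  let f' : G →* ℤˣ := (Equiv.Perm.sign.comp (toPermHom (G ⧸ N) ((G ⧸ N) ⧸ H))).comp π
  -- Without fixed points on 42 cosets, `π k` is a product of 21 transpositions.
  have hf'k : f' k = -1 := by
    have := sign_toPerm_of_sq_eq_one (X := (G ⧸ N) ⧸ H) (t := π k) (by rw [pow_two, hcc])
    rw [hfree, h42] at this
    exact this.trans (by decide)
  have hfk : f k = 1 := by
    change Equiv.Perm.sign (toPermHom G X k) = 1
    rw [MonoidHom.mem_ker.1 hkK, map_one]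
  have hfz : f z = -1 := by
    have h1 : toPermHom G X z = E.permCongr (finRotate 8) := by
      ext p
      obtain ⟨i, rfl⟩ := E.surjective p
      simpa [finRotate_apply] using hE i
    change Equiv.Perm.sign (toPermHom G X z) = -1
    rw [h1, Equiv.Perm.sign_permCongr, sign_finRotate]
    decide
  rw [hz, map_mul, h.map_y_eq_one, mul_one] at hfz
  have hff := h.eq_of_map_x_eq_neg_one hfz (f' := f') fun h1 => by
    rw [h1] at hf'k
    exact absurd hf'k (by rw [MonoidHom.one_apply]; decide)
  rw [hff, hf'k] at hfk
  exact absurd hfk (by decide)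

theorem card_sylow_ne_8 (h : IsTriangleGen x y) (hc : Nat.card G = 2016) :
    Nat.card (Sylow 7 G) ≠ 8 := by
  intro h8
  have f7 : Fact (Nat.Prime 7) := ⟨by norm_num⟩
  have hcard : ∀ P : Sylow 7 G, Nat.card (P : Subgroup G) = 7 := fun P => by
    simpa using P.card_eq_of_card_eq (n := 1) (m := 288) (by rw [hc]; norm_num) (by norm_num)
  obtain ⟨P⟩ : Nonempty (Sylow 7 G) := inferInstance
  obtain ⟨⟨e, heP⟩, he⟩ : ∃ e : (P : Subgroup G), e ≠ 1 := by
    have : Nontrivial (P : Subgroup G) := by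
      rw [← Finite.one_lt_card_iff_nontrivial, hcard P]; norm_num
    exact exists_ne 1
  have he1 : e ≠ 1 := fun h1 => he (Subtype.ext h1)
  have he7 : e ^ 7 = 1 := Subgroup.pow_eq_one_of_card_eq (hcard P) heP
  have heA : ∀ A : Sylow 7 G, e • A = A → A = P := fun A hA =>
    Sylow.eq_of_smul_eq hcard heP hA he1
  obtain ⟨hz4, hE, g, w, hg, hg', hw⟩ :=
    h.exists_conj_of_card_eq_eight h8 he7 (Sylow.self_smul heP) heA
  have he' : ∃ A : Sylow 7 G, e • A ≠ A := by
    by_contra! hcon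
    exact hz4 P ((heA _ (hcon _)))
  -- An image of order at least 336 bounds the kernel by 2016 / 336 = 6; the normaliser of `P`, of
  -- order 252 = 42 · 6, bounds it below.
  refine h.card_ker_toPermHom_ne_six hc hz4 hE hg hg' hw (le_antisymm ?_ ?_)
  · have h1 := Nat.le_of_dvd Nat.card_pos (h.dvd_card_range_toPermHom he7 he' hz4 hg hg' hw)
    have h2 := Subgroup.card_mul_index (toPermHom G (Sylow 7 G)).ker
    rw [Subgroup.index_ker, hc] at h2
    by_contra! h3
    have := Nat.mul_le_mul (Nat.succ_le_of_lt h3) h1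
    omega
  · have h1 := Sylow.card_le_card_ker_toPermHom (P := P) hcard h8
    have h2 := Subgroup.card_mul_index (Subgroup.normalizer (P : Set G))
    rw [← show Nat.card (Sylow 7 G) = (Subgroup.normalizer (P : Set G)).index from
      P.card_eq_index_normalizer, h8, hc] at h2
    omega

/-! ### Sylow count and passage from the presentation -/

theorem card_ne_2016 (h : IsTriangleGen x y) : Nat.card G ≠ 2016 := by
  intro hc
  have f7 : Fact (Nat.Prime 7) := ⟨by norm_num⟩
  obtain ⟨P⟩ : Nonempty (Sylow 7 G) := inferInstance
  have hP : Nat.card (P : Subgroup G) = 7 := by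
    simpa using P.card_eq_of_card_eq (n := 1) (m := 288) (by rw [hc]; norm_num) (by norm_num)
  have h1 := P.card_dvd_index
  have h2 := Subgroup.card_mul_index (P : Subgroup G)
  rw [hP, hc] at h2
  rw [show (P : Subgroup G).index = 288 by omega] at h1
  have h3 : Nat.card (Sylow 7 G) % 7 = 1 := card_sylow_modEq_one 7 G
  have h4 : ∀ n ∈ Nat.divisors 288, n % 7 = 1 → n = 1 ∨ n = 8 ∨ n = 36 ∨ n = 288 := by decide
  rcases h4 _ (Nat.mem_divisors.2 ⟨h1, by norm_num⟩) h3 with h5 | h5 | h5 | h5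
  · exact h.card_sylow_ne_one hc h5
  · exact h.card_sylow_ne_8 hc h5
  · exact h.card_sylow_ne_36 hc h5
  · exact h.card_sylow_ne_288 hc h5

theorem of_surjective {G : Type*} [Group G] {φ : PolygonalGroup ![2, 3, 8] →* G}
    (hφ : Function.Surjective φ) :
    ∃ x y : G, IsTriangleGen x y := by
  have hrel : ∀ r ∈ polygonalRels ![2, 3, 8],
      φ (PresentedGroup.mk (polygonalRels ![2, 3, 8]) r) = 1 := by
    intro r hr
    rw [PresentedGroup.one_of_mem hr, map_one]
  let c : Fin 3 → G := fun i => φ (PresentedGroup.of i)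
  have hpow : ∀ i, c i ^ (![2, 3, 8] : Fin 3 → ℕ) i = 1 := fun i => by
    have := hrel _ (Or.inl ⟨i, rfl⟩)
    rwa [map_pow, map_pow] at this
  have hprod : c 0 * c 1 * c 2 = 1 := by
    have := hrel _ (Or.inr rfl)
    rw [List.ofFn_succ, List.ofFn_succ, List.ofFn_succ, List.ofFn_zero] at this
    simp only [List.prod_cons, List.prod_nil, map_mul, mul_one] at this
    rw [mul_assoc]
    exact this
  refine ⟨c 0, c 1, hpow 0, hpow 1, ?_, ?_⟩
  · rw [eq_inv_of_mul_eq_one_left hprod, inv_pow, inv_eq_one]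
    exact hpow 2
  · have h2 : c 2 = (c 0 * c 1)⁻¹ := eq_inv_of_mul_eq_one_right hprod
    have h3 : Subgroup.closure (Set.range c) = ⊤ := by
      have h4 := φ.map_closure (Set.range PresentedGroup.of)
      rw [PresentedGroup.closure_range_of, Subgroup.map_top_of_surjective φ hφ, ← Set.range_comp] at h4
      exact h4.symm
    rw [← top_le_iff, ← h3, Subgroup.closure_le]
    have h0m : c 0 ∈ Subgroup.closure {c 0, c 1} := Subgroup.subset_closure (by simp)
    have h1m : c 1 ∈ Subgroup.closure {c 0, c 1} := Subgroup.subset_closure (by simp)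
    rintro _ ⟨i, rfl⟩
    fin_cases i
    · exact h0m
    · exact h1m
    · change c 2 ∈ _
      rw [h2]
      exact inv_mem (mul_mem h0m h1m)

end IsTriangleGen

theorem mainTheorem7 (G : Type*) [Group G] (hG : Nat.card G = 1152 ∨ Nat.card G = 2016) :
    ¬ ∃ φ : PolygonalGroup ![2, 3, 8] →* G, Function.Surjective φ := by
  rintro ⟨φ, hφ⟩
  obtain ⟨x, y, h⟩ := IsTriangleGen.of_surjective hφ
  have : Finite G := Nat.finite_of_card_ne_zero (by rcases hG with hG | hG <;> rw [hG] <;> norm_num)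
  exact hG.elim h.card_ne_1152 h.card_ne_2016
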